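/- Conventions. A circle in a Lie group $G$ is a subgroup $S \leq G$ which is, with the subspace topology, isomorphic to $S^1 = \{z \in \mathbb{C} : |z| = 1\}$. A circle $S$ is reflected in $G$ if there is $w \in N_G(S)$ with $w s w^{-1} = s^{-1}$ for all $s \in S$. A subgroup $S$ is conjugate into a subgroup $H \leq G$ if $g S g^{-1} \subseteq H$ for some $g \in G$. $\mathrm{Spin}(m)$ is the compact spin group inside the Clifford algebra of Euclidean $\mathbb{R}^m$, $\pi\colon \mathrm{Spin}(m) \to \mathrm{SO}(m)$ is the double covering, given by $x v x^{-1} = \pi(x) v$, and the standard $\mathrm{Spin}(4n) \leq \mathrm{Spin}(4n+2)$ is the subgroup induced by the inclusion $\mathbb{R}^{4n} \to \mathbb{R}^{4n+2}$, $v \mapsto (v,0,0)$. Proposition. Let $n \geq 0$. (1) Let $S$ be a circle in $\mathrm{Spin}(4n+2)$. Then $S$ is reflected in $\mathrm{Spin}(4n+2)$ if and only if it is conjugate in $\mathrm{Spin}(4n+2)$ into the standard subgroup $\mathrm{Spin}(4n)$; equivalently, if and only if it is conjugate into some subgroup of $\mathrm{Spin}(4n+2)$ isomorphic, as a topological group,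 to $\mathrm{Spin}(4n)$. (2) It is equivalent to work in $\mathrm{SO}(4n+2)$: for a circle $S$ in $\mathrm{Spin}(4n+2)$, the image $\pi(S)$ is a circle in $\mathrm{SO}(4n+2)$; $S$ is reflected in $\mathrm{Spin}(4n+2)$ if and only if $\pi(S)$ is reflected in $\mathrm{SO}(4n+2)$; and $S$ is conjugate into the standard $\mathrm{Spin}(4n)$ if and only if $\pi(S)$ is conjugate in $\mathrm{SO}(4n+2)$ into the block-diagonal subgroup $\mathrm{diag}(\mathrm{SO}(4n),1,1)$. (3) A circle $S$ in $\mathrm{SO}(4n+2)$ is reflected in $\mathrm{SO}(4n+2)$ if and only if it is conjugate into $\mathrm{diag}(\mathrm{SO}(4n),1,1)$. Moreover, some conjugate of $S$ in $\mathrm{SO}(4n+2)$ is the image of an injective homomorphism $S^1 \to \mathrm{SO}(2)^{2n+1}$, $z \mapsto (z^{a_1},\dots,z^{a_{2n+1}})$, into the block-diagonal torus, with exponents $a_j \in \mathbb{Z}$ (where $\mathrm{SO}(2)$ is identified with $S^1$); and for every such family of exponents of $S$, the circle $S$ is reflected in $\mathrm{SO}(4n+2)$ if and only if $a_j = 0$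 for some $j$. -/

import Mathlib

open scoped Matrix

noncomputable section

namespace ReflectedCircles

/-! ### Circles and reflection in a topological group -/

/-- A subgroup `S` of a topological group is a *circle* if, with the subspace topology, it is
isomorphic as a topological group to the unit circle of `ℂ`. In a Lie group such an `S` is compact,
hence a closed (embedded) Lie subgroup, and the isomorphism is automatically smooth. -/
def IsCircle {G : Type*} [Group G] [TopologicalSpace G] (S : Subgroup G) : Prop :=
  Nonempty (Circle ≃ₜ* S)

/-- `S` is *reflected* in `G` if conjugation by some element of its normalizer restricts on `S`
to the inversion `s ↦ s⁻¹`. -/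
def IsReflected {G : Type*} [Group G] (S : Subgroup G) : Prop :=
  ∃ w ∈ Subgroup.normalizer (S : Set G), ∀ s ∈ S, w * s * w⁻¹ = s⁻¹

/-- The subgroup `g S g⁻¹`. -/
def conjSubgroup {G : Type*} [Group G] (g : G) (S : Subgroup G) : Subgroup G :=
  S.map (MulAut.conj g).toMonoidHom

/-- `S` is conjugate (in the ambient group) into the subgroup `H`. -/
def IsConjugateInto {G : Type*} [Group G] (S H : Subgroup G) : Prop :=
  ∃ g : G, conjSubgroup g S ≤ H

/-! ### The compact spin groups -/

/-- The standard quadratic form `∑ xᵢ²` on `ℝᵐ`. -/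
def euclideanForm (m : ℕ) : QuadraticForm ℝ (Fin m → ℝ) :=
  QuadraticMap.weightedSumSquares ℝ (fun _ : Fin m => (1 : ℝ))

/-- The real Clifford algebra of Euclidean `ℝᵐ`. -/
abbrev Cl (m : ℕ) : Type := CliffordAlgebra (euclideanForm m)

/-- The canonical topology of the finite-dimensional real vector space `Cl m`. -/
instance instTopologicalSpaceCl (m : ℕ) : TopologicalSpace (Cl m) :=
  moduleTopology ℝ (Cl m)

/-- The compact group `Spin(m)`, with the subspace topology from the Clifford algebra. -/
abbrev Spin (m : ℕ) : Type := spinGroup (euclideanForm m)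

/-- The special orthogonal group `SO(m)`, with the subspace topology from the matrices. -/
abbrev SO (m : ℕ) : Type := Matrix.specialOrthogonalGroup (Fin m) ℝ

/-- The isometric inclusion `ℝᵏ → ℝᵏ⁺²`, `v ↦ (v, 0, 0)`. -/
def stdIncl (k : ℕ) : euclideanForm k →qᵢ euclideanForm (k + 2) where
  toFun v := Fin.append v (0 : Fin 2 → ℝ)
  map_add' v w := by
    ext i
    refine Fin.addCases (fun i => ?_) (fun i => ?_) i <;> simp
  map_smul' c v := by
    ext i
    refine Fin.addCases (fun i => ?_) (fun i => ?_) i <;> simp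
  map_app' v := by
    simp [euclideanForm, QuadraticMap.weightedSumSquares_apply, Fin.sum_univ_add,
      -Fin.sum_univ_two]

/-- The standard subgroup `Spin(k)` of `Spin(k+2)`: the image of `Spin(k)` under the map of
Clifford algebras induced by `ℝᵏ → ℝᵏ⁺²`, `v ↦ (v, 0, 0)`. -/
def stdSpin (k : ℕ) : Subgroup (Spin (k + 2)) where
  carrier := {x | ∃ y : Spin k, CliffordAlgebra.map (stdIncl k) (y : Cl k) = (x : Cl (k + 2))}
  mul_mem' := by
    rintro _ _ ⟨y, hy⟩ ⟨y', hy'⟩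
    exact ⟨y * y', by simp [hy, hy']⟩
  one_mem' := ⟨1, by simp⟩
  inv_mem' := by
    rintro x ⟨y, hy⟩
    refine ⟨y⁻¹, ?_⟩
    have h1 : CliffordAlgebra.map (stdIncl k) ((y⁻¹ : Spin k) : Cl k) * (x : Cl (k + 2)) = 1 := by
      rw [← hy, ← map_mul, ← Submonoid.coe_mul, inv_mul_cancel, Submonoid.coe_one, map_one]
    have h2 : (x : Cl (k + 2)) * ((x⁻¹ : Spin (k + 2)) : Cl (k + 2)) = 1 := by
      rw [← Submonoid.coe_mul, mul_inv_cancel, Submonoid.coe_one]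
    exact left_inv_eq_right_inv h1 h2

/-- `x ∈ Spin(m)` lies over `A ∈ SO(m)` under the double covering `Spin(m) → SO(m)`, that is,
`x v x⁻¹ = A v` in the Clifford algebra for all `v ∈ ℝᵐ`. -/
def LiesOver {m : ℕ} (x : Spin m) (A : SO m) : Prop :=
  ∀ v : Fin m → ℝ,
    (x : Cl m) * CliffordAlgebra.ι (euclideanForm m) v * ((x⁻¹ : Spin m) : Cl m) =
      CliffordAlgebra.ι (euclideanForm m) ((A : Matrix (Fin m) (Fin m) ℝ) *ᵥ v)

/-- The image in `SO(m)` of a subgroup `S` of `Spin(m)` under the double covering. -/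
def imageSO {m : ℕ} (S : Subgroup (Spin m)) : Subgroup (SO m) where
  carrier := {A | ∃ x ∈ S, LiesOver x A}
  mul_mem' := by
    rintro A B ⟨x, hx, hA⟩ ⟨y, hy, hB⟩
    refine ⟨x * y, S.mul_mem hx hy, fun v => ?_⟩
    rw [show ((A * B : SO m) : Matrix (Fin m) (Fin m) ℝ) = A * B from rfl,
      ← Matrix.mulVec_mulVec, ← hA, ← hB, mul_inv_rev]
    simp only [Submonoid.coe_mul, mul_assoc]
  one_mem' := ⟨1, S.one_mem, fun v => by simp⟩
  inv_mem' := by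
    rintro A ⟨x, hx, hA⟩
    refine ⟨x⁻¹, S.inv_mem hx, fun v => ?_⟩
    have h := hA (((A⁻¹ : SO m) : Matrix (Fin m) (Fin m) ℝ) *ᵥ v)
    rw [Matrix.mulVec_mulVec, ← Submonoid.coe_mul, mul_inv_cancel, Submonoid.coe_one,
      Matrix.one_mulVec] at h
    have h3 : ((x⁻¹ : Spin m) : Cl m) * (x : Cl m) = 1 := by
      rw [← Submonoid.coe_mul, inv_mul_cancel, Submonoid.coe_one]
    rw [← h, inv_inv]
    simp only [mul_assoc, h3, mul_one]
    rw [← mul_assoc, h3, one_mul]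

/-! ### Block-diagonal subgroups of the special orthogonal groups -/

/-- The block-diagonal matrix `diag(A, 1, 1)`. -/
def blockMat (k : ℕ) (A : Matrix (Fin k) (Fin k) ℝ) : Matrix (Fin (k + 2)) (Fin (k + 2)) ℝ :=
  Matrix.reindex finSumFinEquiv finSumFinEquiv
    (Matrix.fromBlocks A 0 0 (1 : Matrix (Fin 2) (Fin 2) ℝ))

theorem blockMat_mul (k : ℕ) (A B : Matrix (Fin k) (Fin k) ℝ) :
    blockMat k (A * B) = blockMat k A * blockMat k B := by
  simp [blockMat, Matrix.submatrix_mul_equiv, Matrix.fromBlocks_multiply]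

theorem blockMat_one (k : ℕ) : blockMat k 1 = 1 := by
  simp [blockMat]

theorem blockMat_mem (k : ℕ) (A : SO k) :
    blockMat k (A : Matrix (Fin k) (Fin k) ℝ) ∈
      Matrix.specialOrthogonalGroup (Fin (k + 2)) ℝ := by
  have hA := Matrix.mem_specialOrthogonalGroup_iff.1 A.2
  have ht : (blockMat k (A : Matrix (Fin k) (Fin k) ℝ))ᵀ
      = blockMat k (A : Matrix (Fin k) (Fin k) ℝ)ᵀ := by
    simp [blockMat, Matrix.fromBlocks_transpose]
  rw [Matrix.mem_specialOrthogonalGroup_iff, Matrix.mem_orthogonalGroup_iff]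
  refine ⟨?_, by simp [blockMat, hA.2]⟩
  rw [ht, ← blockMat_mul, (Matrix.mem_orthogonalGroup_iff _ _).1 hA.1, blockMat_one]

/-- The block-diagonal inclusion `SO(k) → SO(k+2)`, `A ↦ diag(A, 1, 1)`. -/
def blockIncl (k : ℕ) : SO k →* SO (k + 2) where
  toFun A := ⟨blockMat k (A : Matrix (Fin k) (Fin k) ℝ), blockMat_mem k A⟩
  map_one' := Subtype.ext (blockMat_one k)
  map_mul' A B := Subtype.ext (blockMat_mul k A B)

/-- The block-diagonal subgroup `diag(SO(k), 1, 1)` of `SO(k+2)`. -/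
def stdSO (k : ℕ) : Subgroup (SO (k + 2)) := (blockIncl k).range

/-- The planar rotation matrix given by a unit complex number. -/
def rot (z : Circle) : Matrix (Fin 2) (Fin 2) ℝ :=
  !![(z : ℂ).re, -(z : ℂ).im; (z : ℂ).im, (z : ℂ).re]

/-- The bijection between pairs (coordinate in a `2 × 2` block, number of the block) and
`{0, …, 4n+1}`, where block number `j` occupies the positions `2j` and `2j+1`. -/
def blockEquiv (n : ℕ) : Fin 2 × Fin (2 * n + 1) ≃ Fin (4 * n + 2) :=
  (Equiv.prodComm _ _).trans (finProdFinEquiv.trans (finCongr (by ring)))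

theorem rot_one : rot 1 = 1 := by
  ext i j
  fin_cases i <;> fin_cases j <;> simp [rot]

theorem rot_mul (u v : Circle) : rot (u * v) = rot u * rot v := by
  ext i j
  fin_cases i <;> fin_cases j <;> simp [rot, Matrix.mul_apply, Fin.sum_univ_two] <;> ring

theorem rot_det (w : Circle) : (rot w).det = 1 := by
  have h := Circle.normSq_coe w
  rw [Complex.normSq_apply] at h
  simp [rot, Matrix.det_fin_two, h]

theorem rot_transpose (w : Circle) : (rot w)ᵀ = rot w⁻¹ := by
  ext i j
  fin_cases i <;> fin_cases j <;> simp [rot]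

/-- The block-diagonal matrix `diag(z^{a₁}, …, z^{a_{2n+1}})` with `2 × 2` rotation blocks. -/
def torusMat (n : ℕ) (a : Fin (2 * n + 1) → ℤ) (z : Circle) :
    Matrix (Fin (4 * n + 2)) (Fin (4 * n + 2)) ℝ :=
  Matrix.reindex (blockEquiv n) (blockEquiv n) (Matrix.blockDiagonal fun j => rot (z ^ a j))

theorem torusMat_one (n : ℕ) (a : Fin (2 * n + 1) → ℤ) : torusMat n a 1 = 1 := by
  have h : (fun j : Fin (2 * n + 1) => rot ((1 : Circle) ^ a j)) = 1 := by
    funext j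
    simp [rot_one]
  rw [torusMat, h, Matrix.blockDiagonal_one]
  simp

theorem torusMat_mul (n : ℕ) (a : Fin (2 * n + 1) → ℤ) (z w : Circle) :
    torusMat n a (z * w) = torusMat n a z * torusMat n a w := by
  simp [torusMat, Matrix.submatrix_mul_equiv, mul_zpow, rot_mul, Matrix.blockDiagonal_mul]

theorem torusMat_mem (n : ℕ) (a : Fin (2 * n + 1) → ℤ) (z : Circle) :
    torusMat n a z ∈ Matrix.specialOrthogonalGroup (Fin (4 * n + 2)) ℝ := by
  have ht : (torusMat n a z)ᵀ = torusMat n a z⁻¹ := by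
    simp [torusMat, Matrix.blockDiagonal_transpose, rot_transpose]
  rw [Matrix.mem_specialOrthogonalGroup_iff, Matrix.mem_orthogonalGroup_iff]
  refine ⟨?_, by simp [torusMat, Matrix.det_blockDiagonal, rot_det]⟩
  rw [ht, ← torusMat_mul, mul_inv_cancel, torusMat_one]

/-- The homomorphism `z ↦ diag(z^{a₁}, …, z^{a_{2n+1}})` from the circle to the block-diagonal
maximal torus `SO(2)^{2n+1}` of `SO(4n+2)`, with exponents `a₁, …, a_{2n+1} ∈ ℤ`. -/
def torusHom (n : ℕ) (a : Fin (2 * n + 1) → ℤ) : Circle →* SO (4 * n + 2) where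
  toFun z := ⟨torusMat n a z, torusMat_mem n a z⟩
  map_one' := Subtype.ext (torusMat_one n a)
  map_mul' z w := Subtype.ext (torusMat_mul n a z w)

/-- `a` is a family of exponents of the circle `S ≤ SO(4n+2)`: some conjugate of `S` is the circle
`{diag(z^{a₁}, …, z^{a_{2n+1}})}` in the block-diagonal torus, parametrized by an injective
homomorphism from the unit circle. -/
def HasExponents {n : ℕ} (S : Subgroup (SO (4 * n + 2))) (a : Fin (2 * n + 1) → ℤ) : Prop :=
  Function.Injective (torusHom n a) ∧ ∃ g, conjSubgroup g S = (torusHom n a).range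

end ReflectedCircles

end

open scoped Matrix

noncomputable section

namespace ReflectedCircles

section Clifford

open CliffordAlgebra

/-! ### Clifford relations and products of vectors -/

/-! Everything is reduced to the exponents of a circle in a maximal torus of `SO(4n+2)`. Fourier
analysis of the orbit maps splits `ℝ^{4n+2}` into `2n+1` planes on which the circle acts by `z ↦
z^{a_j}` (`exists_rotation_family`, `exists_isDiagonalizer`), and both properties in question turn
out to mean that some `a_j` vanishes.

Reflection (`isReflected_torus_iff`): if `a_j = 0`, flipping one axis in each of the other `2n`
planes inverts the circle and has determinant `(-1)^{2n} = 1`. If no `a_j` vanishes and `w` inverts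
the circle, then `w` anticommutes with `ρ(z) - ρ(z)⁻¹`, which for a generic `z` is a nonzero
multiple of a quarter turn on each plane. After normalization `w` is a conjugate-linear map of
`ℂ^{2n+1}`, so its determinant is not positive (`det_nonpos_of_anticommute`), contradicting `det w =
1`.

Conjugacy into `diag(SO(4n),1,1)` (`isConjugateInto_torus_iff`): it provides a nonzero fixed vector,
which forces some `a_j = 0`; conversely a block with `a_j = 0` can be moved to the last place.

The spin statements follow through the double covering `spinToSO`. Elements of `Spin(m)` are even
products of vectors and act by products of reflections, which gives surjectivity; the kernel lies in
`{1, -1}`. A lift of a reflecting element inverts `ρ(u)` up to sign, and the sign disappears on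
squares, which exhaust the circle (`exists_reflector_of_spinToSO`). For an arbitrary copy of
`Spin(4n)` no comparison with the standard one is needed: every circle homomorphism into `Spin(4n)`
is inverted by an element of that group, since all `2n` planes can be flipped
(`exists_reflector_spin_four_mul`). -/

theorem euclideanForm_apply {m : ℕ} (v : Fin m → ℝ) : euclideanForm m v = v ⬝ᵥ v := by
  simp [euclideanForm, QuadraticMap.weightedSumSquares_apply, dotProduct]

theorem polar_euclideanForm {m : ℕ} (v w : Fin m → ℝ) :
    QuadraticMap.polar (euclideanForm m) v w = 2 * (v ⬝ᵥ w) := by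
  simp only [QuadraticMap.polar, euclideanForm_apply, add_dotProduct, dotProduct_add,
    dotProduct_comm w v]
  ring

theorem ι_sq {m : ℕ} (v : Fin m → ℝ) :
    ι (euclideanForm m) v * ι (euclideanForm m) v = algebraMap ℝ (Cl m) (v ⬝ᵥ v) := by
  rw [ι_sq_scalar, euclideanForm_apply]

theorem ι_mul_ι_swap {m : ℕ} (v w : Fin m → ℝ) :
    ι (euclideanForm m) v * ι (euclideanForm m) w =
      algebraMap ℝ (Cl m) (2 * (v ⬝ᵥ w)) - ι (euclideanForm m) w * ι (euclideanForm m) v := by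
  rw [← polar_euclideanForm, ← ι_mul_ι_add_swap, add_sub_cancel_right]

/-- A vector squares to its squared length in the Clifford algebra, and the form is definite. -/
theorem ι_injective (m : ℕ) : Function.Injective (ι (euclideanForm m)) := by
  intro v w h
  rw [← sub_eq_zero, ← map_sub] at h
  have h2 := ι_sq (v - w)
  rw [h, zero_mul] at h2
  have h3 := (algebraMap ℝ (Cl m)).injective (h2.symm.trans (map_zero _).symm)
  exact sub_eq_zero.1 (dotProduct_self_eq_zero.1 h3)

/-- The product of a list of vectors in the Clifford algebra. -/
def vecProd {m : ℕ} (l : List (Fin m → ℝ)) : Cl m := (l.map (ι (euclideanForm m))).prod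

@[simp] theorem vecProd_nil {m : ℕ} : vecProd ([] : List (Fin m → ℝ)) = 1 := rfl

@[simp] theorem vecProd_cons {m : ℕ} (v : Fin m → ℝ) (l : List (Fin m → ℝ)) :
    vecProd (v :: l) = ι (euclideanForm m) v * vecProd l := by simp [vecProd]

@[simp] theorem vecProd_append {m : ℕ} (l l' : List (Fin m → ℝ)) :
    vecProd (l ++ l') = vecProd l * vecProd l' := by simp [vecProd]

/-- The matrix of the reflection in the hyperplane orthogonal to `v`. -/
def reflMat {m : ℕ} (v : Fin m → ℝ) : Matrix (Fin m) (Fin m) ℝ :=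
  1 - (2 / (v ⬝ᵥ v)) • Matrix.vecMulVec v v

theorem reflMat_mulVec {m : ℕ} (v w : Fin m → ℝ) :
    reflMat v *ᵥ w = w - (2 * (v ⬝ᵥ w) / (v ⬝ᵥ v)) • v := by
  rw [reflMat, Matrix.sub_mulVec, Matrix.one_mulVec, Matrix.smul_mulVec, Matrix.vecMulVec_mulVec]
  congr 1
  ext i
  simp
  ring

theorem reflMat_transpose {m : ℕ} (v : Fin m → ℝ) : (reflMat v)ᵀ = reflMat v := by
  simp [reflMat, Matrix.transpose_sub, Matrix.transpose_smul, Matrix.transpose_vecMulVec]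

theorem reflMat_mul_self {m : ℕ} {v : Fin m → ℝ} (hv : v ≠ 0) : reflMat v * reflMat v = 1 := by
  have h : v ⬝ᵥ v ≠ 0 := fun h => hv (dotProduct_self_eq_zero.1 h)
  apply Matrix.mulVec_injective
  ext1 w
  rw [← Matrix.mulVec_mulVec, Matrix.one_mulVec, reflMat_mulVec, reflMat_mulVec, dotProduct_sub,
    dotProduct_smul, smul_eq_mul, div_mul_cancel₀ _ h, sub_sub, ← add_smul]
  have : 2 * (v ⬝ᵥ w) / (v ⬝ᵥ v) + 2 * (v ⬝ᵥ w - 2 * (v ⬝ᵥ w)) / (v ⬝ᵥ v) = 0 := by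
    field_simp; ring
  rw [this, zero_smul, sub_zero]

theorem reflMat_det {m : ℕ} {v : Fin m → ℝ} (hv : v ≠ 0) : (reflMat v).det = -1 := by
  have h : v ⬝ᵥ v ≠ 0 := fun h => hv (dotProduct_self_eq_zero.1 h)
  have h2 : reflMat v = 1 + Matrix.replicateCol Unit ((-(2 / (v ⬝ᵥ v))) • v) *
      Matrix.replicateRow Unit v := by
    rw [reflMat, sub_eq_add_neg, ← neg_smul]
    congr 1
    ext i j
    simp [Matrix.mul_apply, Matrix.vecMulVec_apply]
    ring
  rw [h2, Matrix.det_one_add_replicateCol_mul_replicateRow, dotProduct_smul, smul_eq_mul]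
  field_simp
  norm_num

/-- The product of the reflections in a list of vectors. -/
def reflProd {m : ℕ} (l : List (Fin m → ℝ)) : Matrix (Fin m) (Fin m) ℝ := (l.map reflMat).prod

@[simp] theorem reflProd_nil {m : ℕ} : reflProd ([] : List (Fin m → ℝ)) = 1 := rfl

@[simp] theorem reflProd_cons {m : ℕ} (v : Fin m → ℝ) (l : List (Fin m → ℝ)) :
    reflProd (v :: l) = reflMat v * reflProd l := by simp [reflProd]

theorem reflProd_mul_transpose {m : ℕ} {l : List (Fin m → ℝ)} (hl : ∀ v ∈ l, v ≠ 0) :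
    reflProd l * (reflProd l)ᵀ = 1 := by
  induction l with
  | nil => simp
  | cons v l ih =>
    rw [reflProd_cons, Matrix.transpose_mul, mul_assoc, ← mul_assoc (reflProd l),
      ih fun w hw => hl w (List.mem_cons_of_mem _ hw), one_mul, reflMat_transpose,
      reflMat_mul_self (hl v List.mem_cons_self)]

theorem reflProd_det {m : ℕ} {l : List (Fin m → ℝ)} (hl : ∀ v ∈ l, v ≠ 0) :
    (reflProd l).det = (-1) ^ l.length := by
  induction l with
  | nil => simp
  | cons v l ih =>
    rw [reflProd_cons, Matrix.det_mul, ih fun w hw => hl w (List.mem_cons_of_mem _ hw),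
      reflMat_det (hl v List.mem_cons_self), List.length_cons, pow_succ']

theorem reflProd_mem {m : ℕ} {l : List (Fin m → ℝ)} (hl : ∀ v ∈ l, v ≠ 0) (he : Even l.length) :
    reflProd l ∈ Matrix.specialOrthogonalGroup (Fin m) ℝ := by
  rw [Matrix.mem_specialOrthogonalGroup_iff, Matrix.mem_orthogonalGroup_iff]
  exact ⟨reflProd_mul_transpose hl, by rw [reflProd_det hl, he.neg_one_pow]⟩

/-- Conjugation by a vector is minus the reflection; the signs cancel in products of even length. -/
theorem ι_mul_ι_eq_reflMat {m : ℕ} {v : Fin m → ℝ} (hv : v ≠ 0) (w : Fin m → ℝ) :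
    ι (euclideanForm m) v * ι (euclideanForm m) w =
      -(ι (euclideanForm m) (reflMat v *ᵥ w) * ι (euclideanForm m) v) := by
  have h : v ⬝ᵥ v ≠ 0 := fun h => hv (dotProduct_self_eq_zero.1 h)
  rw [reflMat_mulVec, map_sub, map_smul, sub_mul, smul_mul_assoc, ι_sq, ι_mul_ι_swap,
    Algebra.smul_def, ← map_mul (algebraMap ℝ (Cl m)), div_mul_cancel₀ _ h]
  abel

theorem vecProd_mul_ι {m : ℕ} {l : List (Fin m → ℝ)} (hl : ∀ v ∈ l, v ≠ 0) (w : Fin m → ℝ) :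
    vecProd l * ι (euclideanForm m) w =
      (-1) ^ l.length * (ι (euclideanForm m) (reflProd l *ᵥ w) * vecProd l) := by
  induction l generalizing w with
  | nil => simp
  | cons v l ih =>
    have hc : ∀ x : Cl m, x * (-1) ^ l.length = (-1) ^ l.length * x := fun x =>
      ((Commute.neg_one_right x).pow_right _).eq
    rw [vecProd_cons, mul_assoc, ih fun w hw => hl w (List.mem_cons_of_mem _ hw), ← mul_assoc, hc,
      mul_assoc, ← mul_assoc (ι _ v), ι_mul_ι_eq_reflMat (hl v List.mem_cons_self),
      Matrix.mulVec_mulVec, ← reflProd_cons, List.length_cons, pow_succ]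
    simp [mul_assoc]

/-- `star` reverses the order and negates each vector, so the product collapses from the inside to
scalars. -/
theorem star_vecProd_mul {m : ℕ} (l : List (Fin m → ℝ)) :
    star (vecProd l) * vecProd l =
      algebraMap ℝ (Cl m) ((-1) ^ l.length * (l.map fun v => v ⬝ᵥ v).prod) := by
  induction l with
  | nil => simp
  | cons v l ih =>
    rw [vecProd_cons, star_mul, mul_assoc, ← mul_assoc _ _ (vecProd l), star_ι, neg_mul, ι_sq,
      neg_mul, mul_neg, Algebra.commutes, ← mul_assoc, ih, ← map_mul, ← map_neg]
    congr 1
    simp [pow_succ]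
    ring

theorem vecProd_mul_star {m : ℕ} (l : List (Fin m → ℝ)) :
    vecProd l * star (vecProd l) =
      algebraMap ℝ (Cl m) ((-1) ^ l.length * (l.map fun v => v ⬝ᵥ v).prod) := by
  induction l with
  | nil => simp
  | cons v l ih =>
    rw [vecProd_cons, star_mul, mul_assoc, ← mul_assoc (vecProd l), ih, star_ι, mul_neg, mul_neg,
      Algebra.commutes, ← mul_assoc, ι_sq, ← map_mul, ← map_neg]
    congr 1
    simp [pow_succ]
    ring

theorem vecProd_mem_evenOdd {m : ℕ} (l : List (Fin m → ℝ)) :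
    vecProd l ∈ evenOdd (euclideanForm m) (l.length : ZMod 2) := by
  induction l with
  | nil => simpa using SetLike.one_mem_graded (evenOdd (euclideanForm m))
  | cons v l ih =>
    rw [vecProd_cons, List.length_cons, Nat.cast_add, Nat.cast_one, add_comm]
    exact SetLike.mul_mem_graded (ι_mem_evenOdd_one _ v) ih

theorem isUnit_ι {m : ℕ} {v : Fin m → ℝ} (hv : v ≠ 0) : IsUnit (ι (euclideanForm m) v) := by
  rw [isUnit_ι_iff, euclideanForm_apply, isUnit_iff_ne_zero]
  exact fun h => hv (dotProduct_self_eq_zero.1 h)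

/-- The factors need not be unit vectors: unitarity only sees the product of the squared lengths. -/
theorem vecProd_mem_spinGroup {m : ℕ} {l : List (Fin m → ℝ)} (hl : ∀ v ∈ l, v ≠ 0)
    (he : Even l.length) (h1 : (l.map fun v => v ⬝ᵥ v).prod = 1) :
    vecProd l ∈ spinGroup (euclideanForm m) := by
  refine ⟨⟨?_, ?_⟩, ?_⟩
  · clear h1 he
    induction l with
    | nil => exact one_mem _
    | cons v l ih =>
      rw [vecProd_cons]
      refine mul_mem ?_ (ih fun w hw => hl w (List.mem_cons_of_mem _ hw))
      obtain ⟨u, hu⟩ := isUnit_ι (hl v List.mem_cons_self)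
      rw [← hu]
      exact ⟨u, Subgroup.subset_closure ⟨v, hu.symm⟩, rfl⟩
  · change vecProd l ∈ unitary (Cl m)
    rw [Unitary.mem_iff, star_vecProd_mul, vecProd_mul_star, h1, he.neg_one_pow]
    simp
  · have h := vecProd_mem_evenOdd l
    rwa [(ZMod.natCast_eq_zero_iff_even).2 he] at h

/-- The group is generated by invertible vectors, and the inverse of a vector is again a vector, up
to scale the same one. -/
theorem exists_vecProd_of_mem_lipschitzGroup {m : ℕ} {x : (Cl m)ˣ}
    (hx : x ∈ lipschitzGroup (euclideanForm m)) :
    ∃ l : List (Fin m → ℝ), (∀ v ∈ l, v ≠ 0) ∧ (x : Cl m) = vecProd l := by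
  have hne : ∀ {y : (Cl m)ˣ} {v : Fin m → ℝ}, ι (euclideanForm m) v = y → v ≠ 0 := by
    rintro y v h rfl
    exact y.ne_zero (h ▸ map_zero _)
  induction hx using Subgroup.closure_induction'' with
  | one => exact ⟨[], by simp, by simp⟩
  | mem y hy =>
    obtain ⟨v, hv⟩ := hy
    exact ⟨[v], by simpa using hne hv, by simp [hv]⟩
  | inv_mem y hy =>
    obtain ⟨v, hv⟩ := hy
    have h0 := hne hv
    have h : v ⬝ᵥ v ≠ 0 := fun h => h0 (dotProduct_self_eq_zero.1 h)
    refine ⟨[(v ⬝ᵥ v)⁻¹ • v], by simp [h, h0], ?_⟩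
    rw [Units.inv_eq_of_mul_eq_one_right]
    rw [vecProd_cons, vecProd_nil, mul_one, ← hv, map_smul, mul_smul_comm, ι_sq,
      Algebra.smul_def, ← map_mul, inv_mul_cancel₀ h, map_one]
  | mul y z _ _ hy hz =>
    obtain ⟨l, hl, h⟩ := hy
    obtain ⟨l', hl', h'⟩ := hz
    refine ⟨l ++ l', ?_, by simp [h, h']⟩
    intro v hv
    rcases List.mem_append.1 hv with hv | hv
    exacts [hl v hv, hl' v hv]

theorem exists_vecProd {m : ℕ} (x : Spin m) :
    ∃ l : List (Fin m → ℝ), (∀ v ∈ l, v ≠ 0) ∧ Even l.length ∧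
      (l.map fun v => v ⬝ᵥ v).prod = 1 ∧ (x : Cl m) = vecProd l := by
  obtain ⟨x, ⟨⟨u, hu, hux⟩, hx⟩, hxe⟩ := x
  obtain ⟨l, hl, h⟩ := exists_vecProd_of_mem_lipschitzGroup hu
  have hxl : x = vecProd l := hux.symm.trans h
  have he : Even l.length := by
    -- An odd product would lie in both the even and the odd part, hence be zero, but it is a unit.
    by_contra ho
    have h1 := vecProd_mem_evenOdd l
    rw [← hxl, (ZMod.natCast_eq_one_iff_odd).2 (Nat.not_even_iff_odd.1 ho)] at h1
    have h2 := (Submodule.disjoint_def.1 (evenOdd_isCompl (euclideanForm m)).disjoint) x hxe h1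
    have h3 : (x : Cl m) ≠ 0 := hux ▸ u.ne_zero
    exact h3 h2
  refine ⟨l, hl, he, ?_, hxl⟩
  have h1 := star_vecProd_mul l
  rw [← hxl, (Unitary.mem_iff.1 hx).1, he.neg_one_pow, one_mul, ← map_one (algebraMap ℝ (Cl m))] at h1
  exact ((algebraMap ℝ (Cl m)).injective h1).symm

/-! ### The double covering -/

theorem coe_mul_coe_inv {m : ℕ} (x : Spin m) : (x : Cl m) * ((x⁻¹ : Spin m) : Cl m) = 1 := by
  rw [← Submonoid.coe_mul, mul_inv_cancel, Submonoid.coe_one]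

theorem coe_inv_mul_coe {m : ℕ} (x : Spin m) : ((x⁻¹ : Spin m) : Cl m) * (x : Cl m) = 1 := by
  rw [← Submonoid.coe_mul, inv_mul_cancel, Submonoid.coe_one]

theorem liesOver_iff {m : ℕ} {x : Spin m} {A : SO m} :
    LiesOver x A ↔ ∀ v : Fin m → ℝ, (x : Cl m) * ι (euclideanForm m) v =
      ι (euclideanForm m) ((A : Matrix (Fin m) (Fin m) ℝ) *ᵥ v) * (x : Cl m) := by
  refine forall_congr' fun v => ⟨fun h => ?_, fun h => ?_⟩
  · rw [← h, mul_assoc _ _ (x : Cl m), coe_inv_mul_coe, mul_one]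
  · rw [h, mul_assoc, coe_mul_coe_inv, mul_one]

theorem LiesOver.unique {m : ℕ} {x : Spin m} {A B : SO m} (hA : LiesOver x A)
    (hB : LiesOver x B) : A = B := by
  apply Subtype.ext
  apply Matrix.mulVec_injective
  ext1 v
  exact ι_injective m ((hA v).symm.trans (hB v))

theorem LiesOver.mul {m : ℕ} {x y : Spin m} {A B : SO m} (hA : LiesOver x A)
    (hB : LiesOver y B) : LiesOver (x * y) (A * B) := by
  rw [liesOver_iff] at *
  intro v
  rw [Submonoid.coe_mul, mul_assoc, hB, ← mul_assoc, hA, mul_assoc, Submonoid.coe_mul,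
    Matrix.mulVec_mulVec]

theorem liesOver_of_vecProd {m : ℕ} {x : Spin m} {A : SO m} {l : List (Fin m → ℝ)}
    (hl : ∀ v ∈ l, v ≠ 0) (he : Even l.length) (hx : (x : Cl m) = vecProd l)
    (hA : (A : Matrix (Fin m) (Fin m) ℝ) = reflProd l) : LiesOver x A := by
  rw [liesOver_iff]
  intro v
  rw [hx, hA, vecProd_mul_ι hl, he.neg_one_pow, one_mul]

theorem exists_liesOver {m : ℕ} (x : Spin m) : ∃ A : SO m, LiesOver x A := by
  obtain ⟨l, hl, he, -, hx⟩ := exists_vecProd x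
  exact ⟨⟨reflProd l, reflProd_mem hl he⟩, liesOver_of_vecProd hl he hx rfl⟩

/-- The covering homomorphism from the spin group to the special orthogonal group. -/
def spinToSO (m : ℕ) : Spin m →* SO m :=
  MonoidHom.mk' (fun x => (exists_liesOver x).choose) fun x y =>
    (exists_liesOver (x * y)).choose_spec.unique
      ((exists_liesOver x).choose_spec.mul (exists_liesOver y).choose_spec)

theorem liesOver_spinToSO {m : ℕ} (x : Spin m) : LiesOver x (spinToSO m x) :=
  (exists_liesOver x).choose_spec

theorem LiesOver.spinToSO_eq {m : ℕ} {x : Spin m} {A : SO m} (h : LiesOver x A) :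
    spinToSO m x = A :=
  (liesOver_spinToSO x).unique h

theorem imageSO_eq_map {m : ℕ} (S : Subgroup (Spin m)) : imageSO S = S.map (spinToSO m) := by
  ext A
  exact ⟨fun ⟨x, hx, h⟩ => ⟨x, hx, h.spinToSO_eq⟩,
    fun ⟨x, hx, h⟩ => ⟨x, hx, h ▸ liesOver_spinToSO x⟩⟩

/-! ### Decomposition of the Clifford algebra along a basis vector -/

/-- The generator of the Clifford algebra given by a standard basis vector. -/
def gen {m : ℕ} (i : Fin m) : Cl m := ι (euclideanForm m) (Pi.single i 1)

theorem gen_mul_self {m : ℕ} (i : Fin m) : gen i * gen i = 1 := by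
  rw [gen, ι_sq]; simp

theorem gen_mul_gen {m : ℕ} {i j : Fin m} (h : i ≠ j) : gen i * gen j = -(gen j * gen i) := by
  rw [gen, gen, ι_mul_ι_swap]; simp [h]

theorem involute_gen {m : ℕ} (i : Fin m) : involute (gen i) = -gen i := involute_ι _

/-- The subalgebra generated by some of the standard basis vectors. -/
def genAlg {m : ℕ} (s : Set (Fin m)) : Subalgebra ℝ (Cl m) := Algebra.adjoin ℝ (gen '' s)

theorem genAlg_univ (m : ℕ) : genAlg (Set.univ : Set (Fin m)) = ⊤ := by
  rw [eq_top_iff, ← adjoin_range_ι, genAlg, Algebra.adjoin_le_iff]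
  rintro _ ⟨v, rfl⟩
  have hv : v = ∑ i, v i • Pi.single i (1 : ℝ) := by
    ext j; simp [Finset.sum_apply, Pi.single_apply]
  rw [hv, map_sum]
  refine Subalgebra.sum_mem _ fun i _ => ?_
  rw [map_smul]
  exact Subalgebra.smul_mem _ (Algebra.subset_adjoin (Set.mem_image_of_mem gen (Set.mem_univ i))) _

theorem involute_mem_genAlg {m : ℕ} {s : Set (Fin m)} {a : Cl m} (ha : a ∈ genAlg s) :
    involute a ∈ genAlg s := by
  induction ha using Algebra.adjoin_induction with
  | mem x hx =>
    obtain ⟨i, hi, rfl⟩ := hx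
    rw [involute_gen]
    exact neg_mem (Algebra.subset_adjoin ⟨i, hi, rfl⟩)
  | algebraMap r => rw [AlgHom.commutes]; exact Subalgebra.algebraMap_mem _ r
  | add x y _ _ hx hy => rw [map_add]; exact add_mem hx hy
  | mul x y _ _ hx hy => rw [map_mul]; exact mul_mem hx hy

/-- The generator anticommutes with every generator in `s`, so moving it past a product costs one
sign per factor, which is the grade involution. -/
theorem gen_mul_eq_involute_mul {m : ℕ} {s : Set (Fin m)} {i : Fin m} (hi : i ∉ s) {a : Cl m}
    (ha : a ∈ genAlg s) : gen i * a = involute a * gen i := by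
  induction ha using Algebra.adjoin_induction with
  | mem x hx =>
    obtain ⟨j, hj, rfl⟩ := hx
    rw [involute_gen, neg_mul, gen_mul_gen]
    rintro rfl
    exact hi hj
  | algebraMap r => rw [AlgHom.commutes, Algebra.commutes]
  | add x y _ _ hx hy => rw [map_add, mul_add, add_mul, hx, hy]
  | mul x y _ _ hx hy => rw [map_mul, ← mul_assoc, hx, mul_assoc, hy, mul_assoc]

/-- Elements of this form are closed under multiplication, because the new generator squares to `1`
and moves past `genAlg s` by the involution. -/
theorem exists_eq_add_gen_mul {m : ℕ} {s : Set (Fin m)} {i : Fin m} (hi : i ∉ s) {x : Cl m}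
    (hx : x ∈ genAlg (insert i s)) : ∃ a ∈ genAlg s, ∃ b ∈ genAlg s, x = a + gen i * b := by
  induction hx using Algebra.adjoin_induction with
  | mem x hx =>
    obtain ⟨j, hj, rfl⟩ := hx
    rcases hj with rfl | hj
    · exact ⟨0, zero_mem _, 1, one_mem _, by simp⟩
    · exact ⟨gen j, Algebra.subset_adjoin ⟨j, hj, rfl⟩, 0, zero_mem _, by simp⟩
  | algebraMap r => exact ⟨_, Subalgebra.algebraMap_mem _ r, 0, zero_mem _, by simp⟩
  | add x y _ _ hx hy =>
    obtain ⟨a, ha, b, hb, rfl⟩ := hx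
    obtain ⟨c, hc, d, hd, rfl⟩ := hy
    exact ⟨_, add_mem ha hc, _, add_mem hb hd, by rw [mul_add]; abel⟩
  | mul x y _ _ hx hy =>
    obtain ⟨a, ha, b, hb, rfl⟩ := hx
    obtain ⟨c, hc, d, hd, rfl⟩ := hy
    refine ⟨a * c + involute b * d, add_mem (mul_mem ha hc) (mul_mem (involute_mem_genAlg hb) hd),
      involute a * d + b * c, add_mem (mul_mem (involute_mem_genAlg ha) hd) (mul_mem hb hc), ?_⟩
    have h1 : gen i * (involute a * d) = a * (gen i * d) := by
      rw [← mul_assoc, gen_mul_eq_involute_mul hi (involute_mem_genAlg ha), involute_involute,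
        mul_assoc]
    have h2 : gen i * b * (gen i * d) = involute b * d := by
      rw [gen_mul_eq_involute_mul hi hb, mul_assoc, ← mul_assoc (gen i), gen_mul_self, one_mul]
    rw [mul_add (gen i), h1, ← mul_assoc (gen i), add_mul, mul_add, mul_add, h2]
    abel

/-- Each new generator at most doubles the dimension. Finiteness makes multiplication continuous for
the module topology. -/
instance instFiniteCl (m : ℕ) : Module.Finite ℝ (Cl m) := by
  have h : ∀ s : Finset (Fin m),
      FiniteDimensional ℝ (Subalgebra.toSubmodule (genAlg (s : Set (Fin m)))) := by
    intro s
    induction s using Finset.induction_on with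
    | empty =>
      rw [genAlg, Finset.coe_empty, Set.image_empty, Algebra.adjoin_empty, Algebra.toSubmodule_bot]
      rw [Submodule.one_eq_span]
      infer_instance
    | insert i s hi ih =>
      refine Submodule.finiteDimensional_of_le (S₂ := Subalgebra.toSubmodule (genAlg (s : Set (Fin m))) ⊔
        (Subalgebra.toSubmodule (genAlg (s : Set (Fin m)))).map (LinearMap.mulLeft ℝ (gen i))) ?_
      intro x hx
      rw [Finset.coe_insert] at hx
      obtain ⟨a, ha, b, hb, rfl⟩ := exists_eq_add_gen_mul (by simpa using hi) hx
      exact Submodule.add_mem_sup ha ⟨b, hb, rfl⟩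
  have h1 := h Finset.univ
  rw [Finset.coe_univ, genAlg_univ, Algebra.top_toSubmodule] at h1
  exact Module.finite_def.2 ((Submodule.fg_top _).1 (Module.finite_def.1 h1))

/-- An even element that commutes with all vectors is a scalar. -/
theorem exists_eq_algebraMap_of_commute {m : ℕ} {x : Cl m} (hx : involute x = x)
    (hc : ∀ i, gen i * x = x * gen i) : ∃ r : ℝ, x = algebraMap ℝ (Cl m) r := by
  have key : ∀ s : Finset (Fin m), x ∈ genAlg (s : Set (Fin m)) →
      x ∈ genAlg (∅ : Set (Fin m)) := by
    intro s
    induction s using Finset.induction_on with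
    | empty => simp
    | insert i s hi ih =>
      intro hs
      rw [Finset.coe_insert] at hs
      obtain ⟨a, ha, b, hb, h⟩ := exists_eq_add_gen_mul (by simpa using hi) hs
      have hi' : i ∉ (s : Set (Fin m)) := by simpa using hi
      -- Conjugation by `gen i` fixes `x` and keeps the sign of the `gen i` term, whereas the
      -- involution, which also fixes `x`, reverses it. Averaging the two expressions eliminates
      -- `gen i`.
      have h1 : x = involute a + gen i * involute b := by
        have h2 : x * gen i * gen i = x := by rw [mul_assoc, gen_mul_self, mul_one]
        rw [← h2, ← hc, h, mul_add, gen_mul_eq_involute_mul hi' ha, gen_mul_eq_involute_mul hi' hb,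
          add_mul, mul_assoc, mul_assoc, gen_mul_self, mul_one, mul_assoc, gen_mul_self, mul_one]
      have h3 : x = involute a - gen i * involute b := by
        rw [← hx, h, map_add, map_mul, involute_gen]
        simp [sub_eq_add_neg]
      have h4 : (2 : ℝ) • x = (2 : ℝ) • involute a := by
        rw [two_smul, two_smul]
        nth_rw 1 [h1]
        rw [h3]
        abel
      have h5 : x = involute a := smul_right_injective _ (two_ne_zero' ℝ) h4
      exact ih (h5 ▸ involute_mem_genAlg ha)
  have h1 := key Finset.univ (by rw [Finset.coe_univ, genAlg_univ]; trivial)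
  rw [genAlg, Set.image_empty, Algebra.adjoin_empty, Algebra.mem_bot] at h1
  obtain ⟨r, hr⟩ := h1
  exact ⟨r, hr.symm⟩

/-- A kernel element is even and commutes with all vectors, so it is a scalar `r`; unitarity then
gives `r² = 1`. -/
theorem eq_one_or_neg_one_of_spinToSO_eq_one {m : ℕ} {x : Spin m} (hx : spinToSO m x = 1) :
    (x : Cl m) = 1 ∨ (x : Cl m) = -1 := by
  have h := liesOver_iff.1 (liesOver_spinToSO x)
  rw [hx] at h
  obtain ⟨r, hr⟩ := exists_eq_algebraMap_of_commute (spinGroup.involute_eq x.2)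
    (fun i => by
      have h1 := h (Pi.single i 1)
      rw [OneMemClass.coe_one, Matrix.one_mulVec] at h1
      exact h1.symm)
  have h1 := spinGroup.star_mul_self_of_mem x.2
  rw [hr, star_algebraMap, ← map_mul, ← map_one (algebraMap ℝ (Cl m))] at h1
  rcases mul_self_eq_one_iff.1 ((algebraMap ℝ (Cl m)).injective h1) with rfl | rfl
  · exact .inl (by simp [hr])
  · exact .inr (by simp [hr])

theorem sq_eq_one_of_spinToSO_eq_one {m : ℕ} {x : Spin m} (hx : spinToSO m x = 1) :
    x * x = 1 := by
  apply Subtype.ext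
  rcases eq_one_or_neg_one_of_spinToSO_eq_one hx with h | h <;> simp [h]

theorem spinToSO_eq_iff {m : ℕ} {x y : Spin m} :
    spinToSO m x = spinToSO m y ↔ (x : Cl m) = y ∨ (x : Cl m) = -y := by
  constructor
  · intro h
    have h1 : spinToSO m (x * y⁻¹) = 1 := by rw [map_mul, map_inv, h, mul_inv_cancel]
    have h2 : (x : Cl m) = ((x * y⁻¹ : Spin m) : Cl m) * y := by
      rw [← Submonoid.coe_mul, inv_mul_cancel_right]
    rcases eq_one_or_neg_one_of_spinToSO_eq_one h1 with h3 | h3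
    · exact .inl (by rw [h2, h3, one_mul])
    · exact .inr (by rw [h2, h3, neg_one_mul])
  · intro h
    refine LiesOver.spinToSO_eq (liesOver_iff.2 fun v => ?_)
    have h1 := liesOver_iff.1 (liesOver_spinToSO y) v
    rcases h with h | h <;> simp [h, h1]

/-! ### Surjectivity of the covering -/

theorem norm_sq_eq_dotProduct {m : ℕ} (v : EuclideanSpace ℝ (Fin m)) :
    ‖v‖ ^ 2 = v.ofLp ⬝ᵥ v.ofLp := by
  rw [EuclideanSpace.real_norm_sq_eq]
  simp [dotProduct, sq]

theorem reflection_eq_reflMat {m : ℕ} (v w : EuclideanSpace ℝ (Fin m)) :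
    ((ℝ ∙ v)ᗮ.reflection w).ofLp = reflMat v.ofLp *ᵥ w.ofLp := by
  rw [Submodule.reflection_orthogonal_apply, Submodule.reflection_singleton_apply, reflMat_mulVec]
  have h1 : inner ℝ v w = v.ofLp ⬝ᵥ w.ofLp := by
    simp [PiLp.inner_apply, dotProduct, mul_comm]
  ext i
  simp [h1, norm_sq_eq_dotProduct]
  ring

theorem reflMat_smul {m : ℕ} {c : ℝ} (hc : c ≠ 0) (v : Fin m → ℝ) :
    reflMat (c • v) = reflMat v := by
  apply Matrix.mulVec_injective
  ext1 w
  rw [reflMat_mulVec, reflMat_mulVec, smul_smul]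
  congr 2
  simp only [smul_dotProduct, dotProduct_smul, smul_eq_mul]
  by_cases h : v ⬝ᵥ v = 0
  · simp [h]
  · field_simp

/-- Zero vectors contribute the identity and are dropped; the others are normalized so that the same
list also defines an element of the spin group. -/
theorem exists_reflProd_eq {m : ℕ} (l : List (EuclideanSpace ℝ (Fin m))) :
    ∃ l' : List (Fin m → ℝ), (∀ v ∈ l', v ⬝ᵥ v = 1) ∧
      ∀ w, ((l.map fun v => (ℝ ∙ v)ᗮ.reflection).prod w).ofLp = reflProd l' *ᵥ w.ofLp := by
  induction l with
  | nil => exact ⟨[], by simp⟩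
  | cons v l ih =>
    obtain ⟨l', hl', h⟩ := ih
    by_cases hv : v = 0
    · refine ⟨l', hl', fun w => ?_⟩
      rw [← h, List.map_cons, List.prod_cons, LinearIsometryEquiv.coe_mul,
        Function.comp_apply, reflection_eq_reflMat]
      simp [hv, reflMat]
    · refine ⟨(‖v‖⁻¹ • v.ofLp) :: l', ?_, fun w => ?_⟩
      · intro u hu
        rcases List.mem_cons.1 hu with rfl | hu
        · have h3 : ‖v‖ ≠ 0 := norm_ne_zero_iff.2 hv
          simp only [smul_dotProduct, dotProduct_smul, smul_eq_mul, ← norm_sq_eq_dotProduct]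
          field_simp
        · exact hl' u hu
      · rw [List.map_cons, List.prod_cons, LinearIsometryEquiv.coe_mul,
        Function.comp_apply, reflection_eq_reflMat, h,
          reflProd_cons, Matrix.mulVec_mulVec, reflMat_smul (inv_ne_zero (norm_ne_zero_iff.2 hv))]

theorem norm_toLp_mulVec {m : ℕ} {A : Matrix (Fin m) (Fin m) ℝ} (hA : Aᵀ * A = 1)
    (v : Fin m → ℝ) : ‖WithLp.toLp 2 (A *ᵥ v)‖ = ‖WithLp.toLp 2 v‖ := by
  rw [← sq_eq_sq₀ (norm_nonneg _) (norm_nonneg _), norm_sq_eq_dotProduct,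
    norm_sq_eq_dotProduct, Matrix.dotProduct_mulVec,
    ← Matrix.mulVec_transpose, Matrix.mulVec_mulVec, hA, Matrix.one_mulVec]

theorem SO.transpose_mul_self {m : ℕ} (A : SO m) :
    (A : Matrix (Fin m) (Fin m) ℝ)ᵀ * A = 1 :=
  (Matrix.mem_orthogonalGroup_iff' _ _).1 (Matrix.mem_specialOrthogonalGroup_iff.1 A.2).1

theorem SO.mul_transpose_self {m : ℕ} (A : SO m) :
    (A : Matrix (Fin m) (Fin m) ℝ) * (A : Matrix (Fin m) (Fin m) ℝ)ᵀ = 1 :=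
  (Matrix.mem_orthogonalGroup_iff _ _).1 (Matrix.mem_specialOrthogonalGroup_iff.1 A.2).1

theorem SO.det_eq_one {m : ℕ} (A : SO m) : (A : Matrix (Fin m) (Fin m) ℝ).det = 1 :=
  (Matrix.mem_specialOrthogonalGroup_iff.1 A.2).2

/-- The linear isometry of Euclidean space given by an orthogonal matrix. -/
def isometryOfMat {m : ℕ} (A : Matrix (Fin m) (Fin m) ℝ) (hA : Aᵀ * A = 1) :
    EuclideanSpace ℝ (Fin m) ≃ₗᵢ[ℝ] EuclideanSpace ℝ (Fin m) :=
  LinearIsometry.toLinearIsometryEquiv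
    { toFun := fun v => WithLp.toLp 2 (A *ᵥ v.ofLp)
      map_add' := fun v w => by simp [Matrix.mulVec_add]
      map_smul' := fun c v => by simp [Matrix.mulVec_smul]
      norm_map' := fun v => norm_toLp_mulVec hA v.ofLp } rfl

@[simp] theorem isometryOfMat_apply {m : ℕ} (A : Matrix (Fin m) (Fin m) ℝ) (hA : Aᵀ * A = 1)
    (v : EuclideanSpace ℝ (Fin m)) : isometryOfMat A hA v = WithLp.toLp 2 (A *ᵥ v.ofLp) := rfl

/-- By Cartan–Dieudonné a rotation is a product of reflections; determinant `1` makes their number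
even, and the product of the unit vectors is a lift. -/
theorem spinToSO_surjective (m : ℕ) : Function.Surjective (spinToSO m) := by
  intro A
  obtain ⟨l, -, hl⟩ := (isometryOfMat _ (SO.transpose_mul_self A)).reflections_generate_dim
  obtain ⟨l', hl', h⟩ := exists_reflProd_eq l
  have hA : (A : Matrix (Fin m) (Fin m) ℝ) = reflProd l' := by
    apply Matrix.mulVec_injective
    ext1 v
    have h1 := h (WithLp.toLp 2 v)
    rw [← hl] at h1
    exact h1
  have hne : ∀ v ∈ l', v ≠ 0 := by
    rintro v hv rfl
    simpa using hl' 0 hv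
  have he : Even l'.length := by
    by_contra ho
    have h1 := reflProd_det hne
    rw [← hA, SO.det_eq_one, (Nat.not_even_iff_odd.1 ho).neg_one_pow] at h1
    norm_num at h1
  have h1 : (l'.map fun v => v ⬝ᵥ v).prod = 1 :=
    List.prod_eq_one (by simpa using hl')
  exact ⟨⟨vecProd l', vecProd_mem_spinGroup hne he h1⟩,
    (liesOver_of_vecProd hne he rfl hA).spinToSO_eq⟩

/-- For a unit vector `e`, `-1 = e * (-e)`; such a vector exists only in positive dimension. -/
theorem neg_one_mem_spinGroup {m : ℕ} (hm : 0 < m) : (-1 : Cl m) ∈ spinGroup (euclideanForm m) := by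
  have h := vecProd_mem_spinGroup (l := [Pi.single (⟨0, hm⟩ : Fin m) (1 : ℝ), -Pi.single ⟨0, hm⟩ 1])
    (by simp) (by simp) (by simp)
  have h2 := gen_mul_self (⟨0, hm⟩ : Fin m)
  rw [gen] at h2
  simpa [h2] using h

/-! ### Continuity of the covering -/

instance instIsModuleTopologyCl (m : ℕ) : IsModuleTopology ℝ (Cl m) := ⟨rfl⟩

/-- The inverse in the spin group is `star`, so a matrix entry is a coordinate of `f (x * gen j *
star x)` with `f` a linear left inverse of `ι`. All maps involved are linear or multiplications in a
finite-dimensional algebra. -/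
theorem continuous_spinToSO (m : ℕ) : Continuous (spinToSO m) := by
  obtain ⟨f, hf⟩ := (ι (euclideanForm m)).exists_leftInverse_of_injective
    (LinearMap.ker_eq_bot.2 (ι_injective m))
  have hf' : ∀ v, f (ι _ v) = v := fun v => LinearMap.congr_fun hf v
  have hmul : Continuous fun p : Cl m × Cl m => p.1 * p.2 :=
    IsModuleTopology.continuous_mul_of_finite ℝ (Cl m)
  refine continuous_induced_rng.2 (continuous_matrix fun i j => ?_)
  have h : ∀ x : Spin m, (spinToSO m x : Matrix (Fin m) (Fin m) ℝ) i j =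
      f ((x : Cl m) * gen j * (star : Cl m → Cl m) x) i := by
    intro x
    have h1 := liesOver_spinToSO x (Pi.single j 1)
    rw [← spinGroup.star_eq_inv, spinGroup.coe_star] at h1
    rw [gen, h1, hf']
    simp
  have : ContinuousAdd (Cl m) := IsModuleTopology.toContinuousAdd ℝ (Cl m)
  have hs : Continuous (star : Cl m → Cl m) :=
    IsModuleTopology.continuous_of_linearMap (R := ℝ)
      ((reverse (Q := euclideanForm m)).comp (involute (Q := euclideanForm m)).toLinearMap)
  have hfc : Continuous f := IsModuleTopology.continuous_of_linearMap f
  refine Continuous.congr ?_ fun x => (h x).symm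
  refine (continuous_apply i).comp (hfc.comp (hmul.comp (Continuous.prodMk
    (hmul.comp (Continuous.prodMk continuous_subtype_val continuous_const))
    (hs.comp continuous_subtype_val))))

end Clifford

/-! ### Orthogonal representations of the circle -/

section Representation

open MeasureTheory AddCircle

variable {V : Type*} [NormedAddCommGroup V] [InnerProductSpace ℝ V]

/-- The cosine coefficient of the orbit map of a vector. -/
def cosCoeff (ρ : Circle →* (V ≃ₗᵢ[ℝ] V)) (a : ℤ) (v : V) : V :=
  ∫ t : AddCircle (1 : ℝ), (fourier a t).re • ρ (toCircle t) v ∂haarAddCircle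

/-- The sine coefficient of the orbit map of a vector. -/
def sinCoeff (ρ : Circle →* (V ≃ₗᵢ[ℝ] V)) (a : ℤ) (v : V) : V :=
  ∫ t : AddCircle (1 : ℝ), (fourier a t).im • ρ (toCircle t) v ∂haarAddCircle

variable {ρ : Circle →* (V ≃ₗᵢ[ℝ] V)}

theorem continuous_orbit (hρ : ∀ v, Continuous fun z => ρ z v) (v : V) :
    Continuous fun t : AddCircle (1 : ℝ) => ρ (toCircle t) v :=
  (hρ v).comp AddCircle.continuous_toCircle

theorem integrable_of_continuous {E : Type*} [NormedAddCommGroup E] {f : AddCircle (1 : ℝ) → E}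
    (hf : Continuous f) : Integrable f haarAddCircle :=
  hf.integrable_of_hasCompactSupport (HasCompactSupport.of_compactSpace f)

theorem integrable_re_smul (hρ : ∀ v, Continuous fun z => ρ z v) (a : ℤ) (v : V) :
    Integrable (fun t : AddCircle (1 : ℝ) => (fourier a t).re • ρ (toCircle t) v) haarAddCircle :=
  integrable_of_continuous
    ((Complex.continuous_re.comp (fourier a).continuous).smul (continuous_orbit hρ v))

theorem integrable_im_smul (hρ : ∀ v, Continuous fun z => ρ z v) (a : ℤ) (v : V) :
    Integrable (fun t : AddCircle (1 : ℝ) => (fourier a t).im • ρ (toCircle t) v) haarAddCircle :=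
  integrable_of_continuous
    ((Complex.continuous_im.comp (fourier a).continuous).smul (continuous_orbit hρ v))

theorem fourier_sub {a : ℤ} (t s : AddCircle (1 : ℝ)) :
    fourier a (t - s) = fourier a t * (starRingEnd ℂ) (fourier a s) := by
  rw [← fourier_neg, fourier_apply, fourier_apply, fourier_apply, smul_sub, sub_eq_add_neg,
    toCircle_add, neg_smul, Circle.coe_mul]

theorem smul_cosCoeff_add_smul_sinCoeff (hρ : ∀ v, Continuous fun z => ρ z v) (a : ℤ) (v : V)
    (c d : ℝ) : c • cosCoeff ρ a v + d • sinCoeff ρ a v =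
      ∫ t : AddCircle (1 : ℝ), (c * (fourier a t).re + d * (fourier a t).im) • ρ (toCircle t) v
        ∂haarAddCircle := by
  rw [cosCoeff, sinCoeff, ← integral_smul, ← integral_smul]
  refine (integral_add ((integrable_re_smul hρ a v).smul c)
    ((integrable_im_smul hρ a v).smul d)).symm.trans ?_
  refine integral_congr_ae (.of_forall fun t => ?_)
  simp [add_smul, mul_smul]

/-- Invariance of Haar measure moves the shift by `s` into the character, and the addition formulas
finish. With `map_sinCoeff` this shows that the two coefficients span an invariant subspace, without
complexifying `V`. -/
theorem map_cosCoeff (hρ : ∀ v, Continuous fun z => ρ z v) (a : ℤ) (v : V)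
    (s : AddCircle (1 : ℝ)) :
    ρ (toCircle s) (cosCoeff ρ a v) =
      (fourier a s).re • cosCoeff ρ a v + (fourier a s).im • sinCoeff ρ a v := by
  have h1 : ρ (toCircle s) (cosCoeff ρ a v) =
      ∫ t : AddCircle (1 : ℝ), (fourier a (s + t - s)).re • ρ (toCircle (s + t)) v
        ∂haarAddCircle := by
    rw [cosCoeff]
    refine ((ρ (toCircle s)).toContinuousLinearEquiv.integral_comp_comm _).symm.trans ?_
    refine integral_congr_ae (.of_forall fun t => ?_)
    simp [toCircle_add]
  rw [h1, integral_add_left_eq_self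
    (fun t : AddCircle (1 : ℝ) => (fourier a (t - s)).re • ρ (toCircle t) v) s,
    smul_cosCoeff_add_smul_sinCoeff hρ]
  refine integral_congr_ae (.of_forall fun t => ?_)
  simp only [fourier_sub]
  congr 1
  simp
  ring

theorem map_sinCoeff (hρ : ∀ v, Continuous fun z => ρ z v) (a : ℤ) (v : V)
    (s : AddCircle (1 : ℝ)) :
    ρ (toCircle s) (sinCoeff ρ a v) =
      (-(fourier a s).im) • cosCoeff ρ a v + (fourier a s).re • sinCoeff ρ a v := by
  have h1 : ρ (toCircle s) (sinCoeff ρ a v) =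
      ∫ t : AddCircle (1 : ℝ), (fourier a (s + t - s)).im • ρ (toCircle (s + t)) v
        ∂haarAddCircle := by
    rw [sinCoeff]
    refine ((ρ (toCircle s)).toContinuousLinearEquiv.integral_comp_comm _).symm.trans ?_
    refine integral_congr_ae (.of_forall fun t => ?_)
    simp [toCircle_add]
  rw [h1, integral_add_left_eq_self
    (fun t : AddCircle (1 : ℝ) => (fourier a (t - s)).im • ρ (toCircle t) v) s,
    smul_cosCoeff_add_smul_sinCoeff hρ]
  refine integral_congr_ae (.of_forall fun t => ?_)
  simp only [fourier_sub]
  congr 1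
  simp
  ring

theorem inner_cosCoeff [CompleteSpace V] (hρ : ∀ v, Continuous fun z => ρ z v) (a : ℤ) (u v : V) :
    inner ℝ u (cosCoeff ρ a v) =
      ∫ t : AddCircle (1 : ℝ), (fourier a t).re * inner ℝ u (ρ (toCircle t) v)
        ∂haarAddCircle := by
  rw [cosCoeff, ← integral_inner (integrable_re_smul hρ a v)]
  simp_rw [inner_smul_right]

theorem inner_sinCoeff [CompleteSpace V] (hρ : ∀ v, Continuous fun z => ρ z v) (a : ℤ) (u v : V) :
    inner ℝ u (sinCoeff ρ a v) =
      ∫ t : AddCircle (1 : ℝ), (fourier a t).im * inner ℝ u (ρ (toCircle t) v)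
        ∂haarAddCircle := by
  rw [sinCoeff, ← integral_inner (integrable_im_smul hρ a v)]
  simp_rw [inner_smul_right]

/-- Each function `t ↦ ⟪u, ρ(t) v⟫` is continuous with only its zeroth Fourier coefficient possibly
nonzero, so its Fourier series sums to it pointwise and it is constant. -/
theorem fixed_of_coeff_eq_zero [CompleteSpace V] (hρ : ∀ v, Continuous fun z => ρ z v) {v : V}
    (h : ∀ a : ℤ, a ≠ 0 → cosCoeff ρ a v = 0 ∧ sinCoeff ρ a v = 0) (z : Circle) : ρ z v = v := by
  refine ext_inner_left ℝ fun u => ?_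
  let f : C(AddCircle (1 : ℝ), ℂ) :=
    ⟨fun t => ((inner ℝ u (ρ (toCircle t) v) : ℝ) : ℂ),
      Complex.continuous_ofReal.comp (continuous_const.inner (continuous_orbit hρ v))⟩
  have hr : Continuous fun t : AddCircle (1 : ℝ) => (inner ℝ u (ρ (toCircle t) v) : ℝ) :=
    continuous_const.inner (continuous_orbit hρ v)
  have h0 : ∀ a : ℤ, a ≠ 0 → fourierCoeff f a = 0 := by
    intro a ha
    have h1 : ∀ t : AddCircle (1 : ℝ), fourier (-a) t • f t =
        (((fourier a t).re * inner ℝ u (ρ (toCircle t) v) : ℝ) : ℂ) -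
          (((fourier a t).im * inner ℝ u (ρ (toCircle t) v) : ℝ) : ℂ) * Complex.I := by
      intro t
      rw [fourier_neg]
      apply Complex.ext <;> simp [f]
    have i1 : Integrable (fun t : AddCircle (1 : ℝ) =>
        (((fourier a t).re * inner ℝ u (ρ (toCircle t) v) : ℝ) : ℂ)) haarAddCircle :=
      integrable_of_continuous (Complex.continuous_ofReal.comp
        ((Complex.continuous_re.comp (fourier a).continuous).mul hr))
    have i2 : Integrable (fun t : AddCircle (1 : ℝ) =>
        (((fourier a t).im * inner ℝ u (ρ (toCircle t) v) : ℝ) : ℂ) * Complex.I) haarAddCircle :=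
      integrable_of_continuous ((Complex.continuous_ofReal.comp
        ((Complex.continuous_im.comp (fourier a).continuous).mul hr)).mul continuous_const)
    rw [fourierCoeff, integral_congr_ae (.of_forall h1), integral_sub i1 i2, integral_mul_const,
      integral_complex_ofReal, integral_complex_ofReal, ← inner_cosCoeff hρ, ← inner_sinCoeff hρ,
      (h a ha).1, (h a ha).2]
    simp
  have hs : Summable (fourierCoeff f) :=
    summable_of_ne_finset_zero (s := {0}) fun a ha => h0 a (by simpa using ha)
  have hconst : ∀ t, f t = fourierCoeff f 0 := by
    intro t
    refine (has_pointwise_sum_fourier_series_of_summable hs t).unique ?_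
    convert hasSum_single (0 : ℤ) ?_ using 1
    · simp
    · intro a ha
      rw [h0 a ha, zero_smul]
  obtain ⟨t, rfl⟩ := (homeomorphCircle (one_ne_zero (α := ℝ))).surjective z
  rw [homeomorphCircle_apply]
  have h2 := (hconst t).trans (hconst 0).symm
  simpa [f] using h2

/-- An orthonormal pair spanning a plane on which the circle acts through a character. -/
structure IsRotationPair (ρ : Circle →* (V ≃ₗᵢ[ℝ] V)) (a : ℤ) (x y : V) : Prop where
  norm_left : inner ℝ x x = (1 : ℝ)
  norm_right : inner ℝ y y = (1 : ℝ)
  orthogonal : inner ℝ x y = (0 : ℝ)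
  map_left : ∀ z : Circle, ρ z x = (((z ^ a : Circle) : ℂ).re) • x + (((z ^ a : Circle) : ℂ).im) • y
  map_right : ∀ z : Circle,
    ρ z y = (-((z ^ a : Circle) : ℂ).im) • x + (((z ^ a : Circle) : ℂ).re) • y

/-- As `a ≠ 0`, some `z` has `z ^ a = i`. It sends the cosine coefficient to the sine coefficient
and the latter to minus the former, so being an isometry makes them orthogonal of equal length;
rescaling suffices. -/
theorem exists_isRotationPair_of_coeff_ne_zero (hρ : ∀ v, Continuous fun z => ρ z v) {a : ℤ}
    (ha : a ≠ 0) {v : V} (h : ¬ (cosCoeff ρ a v = 0 ∧ sinCoeff ρ a v = 0)) :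
    ∃ c : ℝ, IsRotationPair ρ a (c • cosCoeff ρ a v) (c • sinCoeff ρ a v) := by
  set x := cosCoeff ρ a v with hx
  set y := sinCoeff ρ a v with hy
  have hzpow : ∀ t : AddCircle (1 : ℝ), fourier a t = ((toCircle t ^ a : Circle) : ℂ) := fun t => by
    rw [fourier_apply, toCircle_zsmul]
  have hmapx : ∀ z : Circle,
      ρ z x = (((z ^ a : Circle) : ℂ).re) • x + (((z ^ a : Circle) : ℂ).im) • y := fun z => by
    obtain ⟨t, rfl⟩ := (homeomorphCircle (one_ne_zero (α := ℝ))).surjective z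
    rw [homeomorphCircle_apply, ← hzpow]
    exact map_cosCoeff hρ a v t
  have hmapy : ∀ z : Circle,
      ρ z y = (-((z ^ a : Circle) : ℂ).im) • x + (((z ^ a : Circle) : ℂ).re) • y := fun z => by
    obtain ⟨t, rfl⟩ := (homeomorphCircle (one_ne_zero (α := ℝ))).surjective z
    rw [homeomorphCircle_apply, ← hzpow]
    exact map_sinCoeff hρ a v t
  obtain ⟨z, hz⟩ : ∃ z : Circle, ((z ^ a : Circle) : ℂ) = Complex.I := by
    refine ⟨Circle.exp (Real.pi / 2 / a), ?_⟩
    rw [← Circle.exp_zsmul, Circle.coe_exp, zsmul_eq_mul, mul_div_cancel₀ _ (by exact_mod_cast ha)]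
    push_cast
    exact Complex.exp_pi_div_two_mul_I
  have h1 : ρ z x = y := by rw [hmapx, hz]; simp
  have h2 : ρ z y = -x := by rw [hmapy, hz]; simp
  have h3 : inner ℝ x x = (inner ℝ y y : ℝ) := by
    rw [← h1, LinearIsometryEquiv.inner_map_map]
  have h4 : inner ℝ x y = (0 : ℝ) := by
    have h5 : inner ℝ (ρ z x) (ρ z y) = (inner ℝ x y : ℝ) := LinearIsometryEquiv.inner_map_map _ _ _
    rw [h1, h2, inner_neg_right, real_inner_comm] at h5
    linarith
  have h5 : ‖x‖ ≠ 0 := by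
    intro h6
    refine h ⟨norm_eq_zero.1 h6, ?_⟩
    rw [← h1, norm_eq_zero.1 h6, map_zero]
  refine ⟨‖x‖⁻¹, ?_, ?_, ?_, ?_, ?_⟩
  · rw [inner_smul_left, inner_smul_right, real_inner_self_eq_norm_sq]
    simp
    field_simp
  · rw [inner_smul_left, inner_smul_right, ← h3, real_inner_self_eq_norm_sq]
    simp
    field_simp
  · rw [inner_smul_left, inner_smul_right, h4]
    simp
  · intro w
    rw [map_smul, hmapx, smul_add, smul_comm _ _ x, smul_comm _ _ y]
  · intro w
    rw [map_smul, hmapy, smul_add, smul_comm _ _ x, smul_comm _ _ y]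

/-! ### Splitting an even-dimensional representation into rotation planes -/

theorem isRotationPair_zero_of_fixed {x y : V} (hx : inner ℝ x x = (1 : ℝ))
    (hy : inner ℝ y y = (1 : ℝ)) (hxy : inner ℝ x y = (0 : ℝ)) (hfx : ∀ z, ρ z x = x)
    (hfy : ∀ z, ρ z y = y) : IsRotationPair ρ 0 x y :=
  ⟨hx, hy, hxy, fun z => by simp [hfx], fun z => by simp [hfy]⟩

theorem inner_map_eq_inner_inv_map (z : Circle) (u v : V) :
    inner ℝ u (ρ z v) = (inner ℝ (ρ z⁻¹ u) v : ℝ) := by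
  rw [← LinearIsometryEquiv.inner_map_map (ρ z) (ρ z⁻¹ u) v, ← Function.comp_apply (f := ρ z),
    ← LinearIsometryEquiv.coe_mul, ← map_mul, mul_inv_cancel, map_one]
  rfl

theorem IsRotationPair.inner_map_eq_zero {a : ℤ} {x y v : V} (h : IsRotationPair ρ a x y)
    (hx : inner ℝ x v = (0 : ℝ)) (hy : inner ℝ y v = (0 : ℝ)) (z : Circle) :
    inner ℝ x (ρ z v) = (0 : ℝ) ∧ inner ℝ y (ρ z v) = (0 : ℝ) := by
  rw [inner_map_eq_inner_inv_map, inner_map_eq_inner_inv_map, h.map_left, h.map_right]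
  simp [inner_add_left, inner_smul_left, hx, hy]

/-- A new pair is found in the complement `Wᗮ` of the earlier ones. If the circle fixes `Wᗮ`, any
two orthonormal vectors serve with exponent `0`; otherwise a moved vector has a nonzero coefficient
at a nonzero frequency. -/
theorem exists_rotation_family [FiniteDimensional ℝ V] (hρ : ∀ v, Continuous fun z => ρ z v)
    {k : ℕ} (hV : Module.finrank ℝ V = 2 * k) (j : ℕ) (hj : j ≤ k) :
    ∃ (p q : Fin j → V) (a : Fin j → ℤ), (∀ i, IsRotationPair ρ (a i) (p i) (q i)) ∧
      ∀ i i', i ≠ i' → inner ℝ (p i) (p i') = (0 : ℝ) ∧ inner ℝ (p i) (q i') = (0 : ℝ) ∧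
        inner ℝ (q i) (p i') = (0 : ℝ) ∧ inner ℝ (q i) (q i') = (0 : ℝ) := by
  have : CompleteSpace V := FiniteDimensional.complete ℝ V
  induction j with
  | zero => exact ⟨Fin.elim0, Fin.elim0, Fin.elim0, fun i => i.elim0, fun i => i.elim0⟩
  | succ j ih =>
    obtain ⟨p, q, a, hpq, ho⟩ := ih (by omega)
    suffices H : ∃ (b : ℤ) (x y : V), IsRotationPair ρ b x y ∧
        ∀ i, inner ℝ (p i) x = (0 : ℝ) ∧ inner ℝ (p i) y = (0 : ℝ) ∧
          inner ℝ (q i) x = (0 : ℝ) ∧ inner ℝ (q i) y = (0 : ℝ) by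
      obtain ⟨b, x, y, hxy, h⟩ := H
      refine ⟨Fin.cons x p, Fin.cons y q, Fin.cons b a, ?_, ?_⟩
      · exact Fin.cases hxy hpq
      · intro i i'
        refine Fin.cases ?_ (fun i => ?_) i <;> refine Fin.cases ?_ (fun i' => ?_) i'
        · simp
        · intro _
          simp only [Fin.cons_zero, Fin.cons_succ]
          rw [real_inner_comm, real_inner_comm (q i'), real_inner_comm _ y, real_inner_comm _ y]
          exact ⟨(h i').1, (h i').2.2.1, (h i').2.1, (h i').2.2.2⟩
        · intro _
          simpa only [Fin.cons_zero, Fin.cons_succ] using h i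
        · intro hne
          simpa only [Fin.cons_succ] using ho i i' (fun h => hne (by rw [h]))
    let W : Submodule ℝ V := Submodule.span ℝ (Set.range (Sum.elim p q))
    have hW : ∀ v, v ∈ Wᗮ ↔ ∀ i, inner ℝ (p i) v = (0 : ℝ) ∧ inner ℝ (q i) v = (0 : ℝ) := by
      intro v
      rw [Submodule.mem_orthogonal]
      constructor
      · exact fun h i => ⟨h _ (Submodule.subset_span ⟨Sum.inl i, rfl⟩),
          h _ (Submodule.subset_span ⟨Sum.inr i, rfl⟩)⟩
      · intro h u hu
        induction hu using Submodule.span_induction with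
        | mem u hu =>
          obtain ⟨i | i, rfl⟩ := hu
          exacts [(h i).1, (h i).2]
        | zero => simp
        | add u w _ _ hu hw => rw [inner_add_left, hu, hw, add_zero]
        | smul c u _ hu => rw [inner_smul_left, hu, mul_zero]
    by_cases hfix : ∀ v ∈ Wᗮ, ∀ z, ρ z v = v
    -- `W` is spanned by `2j` vectors in dimension `2k` with `j + 1 ≤ k`; evenness prevents a single
    -- fixed line from being left over.
    · have hd : 2 ≤ Module.finrank ℝ Wᗮ := by
        have h1 : Module.finrank ℝ W ≤ Fintype.card (Fin j ⊕ Fin j) := finrank_range_le_card _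
        have h2 := W.finrank_add_finrank_orthogonal
        simp only [Fintype.card_sum, Fintype.card_fin] at h1
        omega
      let b := stdOrthonormalBasis ℝ Wᗮ
      let x := b ⟨0, by omega⟩
      let y := b ⟨1, by omega⟩
      have hb := orthonormal_iff_ite.1 b.orthonormal
      refine ⟨0, x, y, isRotationPair_zero_of_fixed ?_ ?_ ?_ (hfix x x.2) (hfix y y.2), fun i =>
        ⟨((hW x).1 x.2 i).1, ((hW y).1 y.2 i).1, ((hW x).1 x.2 i).2, ((hW y).1 y.2 i).2⟩⟩
      · exact (hb _ _).trans (if_pos rfl)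
      · exact (hb _ _).trans (if_pos rfl)
      · exact (hb _ _).trans (if_neg (by simp))
    · push Not at hfix
      obtain ⟨v, hv, z, hz⟩ := hfix
      have h1 : ∃ b : ℤ, b ≠ 0 ∧ ¬ (cosCoeff ρ b v = 0 ∧ sinCoeff ρ b v = 0) := by
        by_contra! h
        exact hz (fixed_of_coeff_eq_zero hρ h z)
      obtain ⟨b, hb, hb'⟩ := h1
      obtain ⟨c, hc⟩ := exists_isRotationPair_of_coeff_ne_zero hρ hb hb'
      refine ⟨b, _, _, hc, fun i => ?_⟩
      have h2 := (hW v).1 hv i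
      -- The whole orbit of `v` is orthogonal to the earlier pairs, hence so are its integrals.
      have h3 := (hpq i).inner_map_eq_zero h2.1 h2.2
      simp [inner_smul_right, inner_cosCoeff hρ, inner_sinCoeff hρ, h3]

end Representation

/-! ### Block-diagonal matrices -/

section Blocks

variable {m k : ℕ} (e : Fin 2 × Fin k ≃ Fin m)

/-- The block-diagonal matrix with rotation blocks, for an arbitrary arrangement of the blocks. -/
def rotMat (a : Fin k → ℤ) (z : Circle) : Matrix (Fin m) (Fin m) ℝ :=
  Matrix.reindex e e (Matrix.blockDiagonal fun j => rot (z ^ a j))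

/-- The reflection of the plane in the first axis. -/
def flip : Matrix (Fin 2) (Fin 2) ℝ := !![1, 0; 0, -1]

theorem flip_mul_flip : flip * flip = 1 := by
  ext i j
  fin_cases i <;> fin_cases j <;> simp [flip]

theorem flip_transpose : flipᵀ = flip := by
  ext i j
  fin_cases i <;> fin_cases j <;> simp [flip]

theorem flip_mul_rot_mul_flip (z : Circle) : flip * rot z * flip = rot z⁻¹ := by
  ext i j
  fin_cases i <;> fin_cases j <;> simp [flip, rot]

/-- The block-diagonal matrix that reflects the blocks in a given set. -/
def flipMat (s : Finset (Fin k)) : Matrix (Fin m) (Fin m) ℝ :=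
  Matrix.reindex e e (Matrix.blockDiagonal fun j => if j ∈ s then flip else 1)

theorem flipMat_transpose (s : Finset (Fin k)) : (flipMat e s)ᵀ = flipMat e s := by
  rw [flipMat, Matrix.transpose_reindex, Matrix.blockDiagonal_transpose]
  congr 2
  ext1 j
  split_ifs <;> simp [flip_transpose]

theorem flipMat_mul_self (s : Finset (Fin k)) : flipMat e s * flipMat e s = 1 := by
  have h : (fun j => (if j ∈ s then flip else 1) * (if j ∈ s then flip else 1)) =
      (1 : Fin k → Matrix (Fin 2) (Fin 2) ℝ) := by
    funext j
    split_ifs <;> simp [flip_mul_flip]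
  simp only [flipMat, Matrix.reindex_apply, Matrix.submatrix_mul_equiv,
    ← Matrix.blockDiagonal_mul]
  rw [h, Matrix.blockDiagonal_one, Matrix.submatrix_one_equiv]

theorem flipMat_det (s : Finset (Fin k)) : (flipMat e s).det = (-1) ^ s.card := by
  rw [flipMat, Matrix.det_reindex_self, Matrix.det_blockDiagonal]
  have h : ∀ j, (if j ∈ s then flip else 1).det = if j ∈ s then (-1 : ℝ) else 1 := by
    intro j
    split_ifs <;> simp [flip, Matrix.det_fin_two]
  simp_rw [h]
  rw [Finset.prod_ite_mem, Finset.univ_inter, Finset.prod_const]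

theorem flipMat_mul_rotMat_mul_flipMat (s : Finset (Fin k)) (a : Fin k → ℤ) (z : Circle) :
    flipMat e s * rotMat e a z * flipMat e s = rotMat e (fun j => if j ∈ s then -a j else a j) z := by
  simp only [flipMat, rotMat, Matrix.reindex_apply, Matrix.submatrix_mul_equiv,
    ← Matrix.blockDiagonal_mul]
  congr 2
  ext1 j
  split_ifs <;> simp [flip_mul_rot_mul_flip]

theorem rotMat_neg (a : Fin k → ℤ) (z : Circle) : rotMat e (fun j => -a j) z = rotMat e a z⁻¹ := by
  simp [rotMat]

/-- An orthogonal matrix that conjugates a homomorphism from the circle into block form. -/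
structure IsDiagonalizer (ρ : Circle →* SO m) (G : Matrix (Fin m) (Fin m) ℝ) (a : Fin k → ℤ) :
    Prop where
  orthogonal : G * Gᵀ = 1
  conj : ∀ z, G * (ρ z : Matrix (Fin m) (Fin m) ℝ) * Gᵀ = rotMat e a z

variable {e}

theorem IsDiagonalizer.orthogonal' {ρ : Circle →* SO m} {G : Matrix (Fin m) (Fin m) ℝ}
    {a : Fin k → ℤ} (h : IsDiagonalizer e ρ G a) : Gᵀ * G = 1 :=
  mul_eq_one_comm.1 h.orthogonal

theorem IsDiagonalizer.eq_conj {ρ : Circle →* SO m} {G : Matrix (Fin m) (Fin m) ℝ}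
    {a : Fin k → ℤ} (h : IsDiagonalizer e ρ G a) (z : Circle) :
    (ρ z : Matrix (Fin m) (Fin m) ℝ) = Gᵀ * rotMat e a z * G := by
  rw [← h.conj, mul_assoc, mul_assoc, h.orthogonal', mul_one, ← mul_assoc, h.orthogonal', one_mul]

theorem IsDiagonalizer.flip {ρ : Circle →* SO m} {G : Matrix (Fin m) (Fin m) ℝ}
    {a : Fin k → ℤ} (h : IsDiagonalizer e ρ G a) (s : Finset (Fin k)) :
    IsDiagonalizer e ρ (flipMat e s * G) (fun j => if j ∈ s then -a j else a j) := by
  constructor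
  · rw [Matrix.transpose_mul, mul_assoc, ← mul_assoc G, h.orthogonal, one_mul, flipMat_transpose,
      flipMat_mul_self]
  · intro z
    rw [← flipMat_mul_rotMat_mul_flipMat, ← h.conj, Matrix.transpose_mul, flipMat_transpose]
    simp only [mul_assoc]

/-- After reversing the orientation of one block, a diagonalizer can be taken of determinant one. -/
theorem IsDiagonalizer.exists_specialOrthogonal {ρ : Circle →* SO m}
    {G : Matrix (Fin m) (Fin m) ℝ} {a : Fin k → ℤ} (h : IsDiagonalizer e ρ G a) (j : Fin k) :
    ∃ (g : SO m) (b : Fin k → ℤ), IsDiagonalizer e ρ g b ∧ (a j = 0 → b j = 0) := by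
  have hdet : G.det = 1 ∨ G.det = -1 := by
    have h1 := congrArg Matrix.det h.orthogonal
    rw [Matrix.det_mul, Matrix.det_transpose, Matrix.det_one] at h1
    exact mul_self_eq_one_iff.1 h1
  rcases hdet with hd | hd
  · exact ⟨⟨G, Matrix.mem_specialOrthogonalGroup_iff.2
      ⟨(Matrix.mem_orthogonalGroup_iff _ _).2 h.orthogonal, hd⟩⟩, a, h, id⟩
  -- Flipping block `j` repairs the determinant at the cost of replacing `a j` by `-a j`, which
  -- keeps a zero exponent zero.
  · have h2 := h.flip {j}
    exact ⟨⟨flipMat e {j} * G, Matrix.mem_specialOrthogonalGroup_iff.2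
      ⟨(Matrix.mem_orthogonalGroup_iff _ _).2 h2.orthogonal, by
        rw [Matrix.det_mul, flipMat_det, hd]; simp⟩⟩, _, h2, fun h0 => by simp [h0]⟩

/-- Flip the blocks in `s`; the others are acted on trivially and need no inversion. Evenness of `s`
gives determinant `1`. -/
theorem IsDiagonalizer.exists_reflector {ρ : Circle →* SO m} {G : Matrix (Fin m) (Fin m) ℝ}
    {a : Fin k → ℤ} (h : IsDiagonalizer e ρ G a) {s : Finset (Fin k)} (hs : Even s.card)
    (ha : ∀ j ∉ s, a j = 0) : ∃ w : SO m, ∀ z, w * ρ z * w⁻¹ = (ρ z)⁻¹ := by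
  let C := flipMat e s
  have hC : Cᵀ = C := flipMat_transpose e s
  have hCC : C * C = 1 := flipMat_mul_self e s
  have hmul : (Gᵀ * C * G) * (Gᵀ * C * G) = 1 := by
    calc (Gᵀ * C * G) * (Gᵀ * C * G) = Gᵀ * C * (G * Gᵀ) * C * G := by simp only [mul_assoc]
      _ = 1 := by rw [h.orthogonal, mul_one, mul_assoc Gᵀ, hCC, mul_one, h.orthogonal']
  have hw : Gᵀ * C * G ∈ Matrix.specialOrthogonalGroup (Fin m) ℝ := by
    rw [Matrix.mem_specialOrthogonalGroup_iff, Matrix.mem_orthogonalGroup_iff]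
    constructor
    · have ht : (Gᵀ * C * G)ᵀ = Gᵀ * C * G := by
        simp only [Matrix.transpose_mul, Matrix.transpose_transpose, hC, mul_assoc]
      rw [ht, hmul]
    · have h1 := congrArg Matrix.det h.orthogonal
      rw [Matrix.det_mul, Matrix.det_transpose, Matrix.det_one] at h1
      rw [Matrix.det_mul, Matrix.det_mul, Matrix.det_transpose, flipMat_det, hs.neg_one_pow,
        mul_one, h1]
  have hww : (⟨_, hw⟩ : SO m)⁻¹ = ⟨_, hw⟩ := inv_eq_of_mul_eq_one_left (Subtype.ext hmul)
  refine ⟨⟨_, hw⟩, fun z => ?_⟩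
  rw [hww, ← map_inv]
  apply Subtype.ext
  have hneg : (fun j => if j ∈ s then -a j else a j) = fun j => -a j := by
    funext j
    split_ifs with hj
    · rfl
    · rw [ha j hj, neg_zero]
  calc (Gᵀ * C * G) * (ρ z : Matrix (Fin m) (Fin m) ℝ) * (Gᵀ * C * G)
      = Gᵀ * (C * (G * (ρ z : Matrix (Fin m) (Fin m) ℝ) * Gᵀ) * C) * G := by
        simp only [mul_assoc]
    _ = ρ z⁻¹ := by
        rw [h.conj, flipMat_mul_rotMat_mul_flipMat, hneg, rotMat_neg, ← h.eq_conj]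

/-- The isometries of Euclidean space given by a homomorphism into the special orthogonal group. -/
def isometryHom (ρ : Circle →* SO m) :
    Circle →* (EuclideanSpace ℝ (Fin m) ≃ₗᵢ[ℝ] EuclideanSpace ℝ (Fin m)) :=
  MonoidHom.mk' (fun z => isometryOfMat _ (SO.transpose_mul_self (ρ z))) fun z w => by
    ext v : 1
    simp [Matrix.mulVec_mulVec]

/-- The rows of `G` are the vectors of a rotation family, arranged by `e`. Its determinant may still
be `-1`. -/
theorem exists_isDiagonalizer (e : Fin 2 × Fin k ≃ Fin m) {ρ : Circle →* SO m}
    (hρ : Continuous ρ) : ∃ G a, IsDiagonalizer e ρ G a := by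
  have hm : m = 2 * k := by simpa using (Fintype.card_congr e).symm
  have hcont : ∀ v, Continuous fun z => isometryHom ρ z v := by
    intro v
    refine (PiLp.continuous_toLp 2 _).comp ?_
    exact Continuous.matrix_mulVec (continuous_subtype_val.comp hρ) continuous_const
  obtain ⟨p, q, a, hpq, ho⟩ := exists_rotation_family hcont (k := k) (by simp [hm]) k le_rfl
  let c : Fin 2 × Fin k → EuclideanSpace ℝ (Fin m) := fun x => if x.1 = 0 then p x.2 else q x.2
  let G : Matrix (Fin m) (Fin m) ℝ := Matrix.of fun r => (c (e.symm r)).ofLp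
  have hc : ∀ x y, inner ℝ (c x) (c y) = if x = y then (1 : ℝ) else 0 := by
    rintro ⟨δ, i⟩ ⟨ε, j⟩
    by_cases hij : i = j
    · subst hij
      have h1 := (hpq i).norm_left
      have h2 := (hpq i).norm_right
      have h3 := (hpq i).orthogonal
      have h4 := h3
      rw [real_inner_comm] at h4
      fin_cases δ <;> fin_cases ε
      exacts [by simpa [c] using h1, by simpa [c] using h3, by simpa [c] using h4,
        by simpa [c] using h2]
    · have h := ho i j hij
      fin_cases δ <;> fin_cases ε <;> simp [c, h, hij]
  have hG : G * Gᵀ = 1 := by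
    ext r s
    have h := hc (e.symm r) (e.symm s)
    rw [real_inner_comm] at h
    simpa [G, Matrix.mul_apply, PiLp.inner_apply, Matrix.one_apply] using h
  refine ⟨G, a, hG, fun z => ?_⟩
  have key : (ρ z : Matrix (Fin m) (Fin m) ℝ) * Gᵀ = Gᵀ * rotMat e a z := by
    ext r s
    obtain ⟨⟨ε, i⟩, rfl⟩ := e.surjective s
    have h1 : ((ρ z : Matrix (Fin m) (Fin m) ℝ) * Gᵀ) r (e (ε, i)) =
        (isometryHom ρ z (c (ε, i))).ofLp r := by
      simp [G, isometryHom, Matrix.mul_apply, Matrix.mulVec, dotProduct]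
    have h2 : (Gᵀ * rotMat e a z) r (e (ε, i)) =
        ∑ δ, (c (δ, i)).ofLp r * rot (z ^ a i) δ ε := by
      rw [Matrix.mul_apply, ← e.sum_comp, Fintype.sum_prod_type]
      refine Finset.sum_congr rfl fun δ _ => ?_
      rw [Finset.sum_eq_single i]
      · simp [G, rotMat]
      · intro j _ hj
        simp [rotMat, Matrix.blockDiagonal_apply, hj]
      · simp
    rw [h1, h2]
    have h3 := (hpq i).map_left z
    have h4 := (hpq i).map_right z
    fin_cases ε
    · simp [c, h3, rot]; ring
    · simp [c, h4, rot]; ring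
  rw [mul_assoc, key, ← mul_assoc, hG, one_mul]

end Blocks

/-! ### Reflected subgroups and conjugation -/

section Groups

variable {G : Type*} [Group G]

/-- Membership in the normalizer is automatic for an element that inverts `S`. -/
theorem isReflected_iff {S : Subgroup G} :
    IsReflected S ↔ ∃ w : G, ∀ s ∈ S, w * s * w⁻¹ = s⁻¹ := by
  refine ⟨fun ⟨w, _, h⟩ => ⟨w, h⟩, fun ⟨w, h⟩ => ⟨w, ?_, h⟩⟩
  rw [Subgroup.mem_normalizer_iff]
  intro s
  refine ⟨fun hs => by rw [h s hs]; exact S.inv_mem hs, fun hs => ?_⟩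
  have h1 := h _ hs
  have h2 : w * s * w⁻¹ = w * (s⁻¹)⁻¹ * w⁻¹ := by rw [inv_inv]
  have h3 : s = (w * s * w⁻¹)⁻¹ := by
    -- Inverting the element `w s w⁻¹` of `S` and cancelling one conjugation by `w` gives `w s w⁻¹ =
    -- s⁻¹`, so `s` itself lies in `S`.
    have h4 : w * (w * s * w⁻¹) * w⁻¹ = w * s⁻¹ * w⁻¹ := by rw [h1]; group
    have h5 := mul_left_cancel (mul_right_cancel h4)
    rw [h5, inv_inv]
  rw [h3]
  exact S.inv_mem hs

theorem mem_conjSubgroup {g x : G} {S : Subgroup G} :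
    x ∈ conjSubgroup g S ↔ ∃ s ∈ S, g * s * g⁻¹ = x := by
  simp [conjSubgroup, Subgroup.mem_map]

theorem conjSubgroup_conjSubgroup (g h : G) (S : Subgroup G) :
    conjSubgroup g (conjSubgroup h S) = conjSubgroup (g * h) S := by
  ext x
  simp only [mem_conjSubgroup]
  constructor
  · rintro ⟨_, ⟨s, hs, rfl⟩, rfl⟩
    exact ⟨s, hs, by group⟩
  · rintro ⟨s, hs, rfl⟩
    exact ⟨_, ⟨s, hs, rfl⟩, by group⟩

theorem conjSubgroup_one (S : Subgroup G) : conjSubgroup 1 S = S := by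
  ext x
  simp [mem_conjSubgroup]

theorem IsReflected.conj {S : Subgroup G} (h : IsReflected S) (g : G) :
    IsReflected (conjSubgroup g S) := by
  rw [isReflected_iff] at *
  obtain ⟨w, hw⟩ := h
  refine ⟨g * w * g⁻¹, fun x hx => ?_⟩
  obtain ⟨s, hs, rfl⟩ := mem_conjSubgroup.1 hx
  calc g * w * g⁻¹ * (g * s * g⁻¹) * (g * w * g⁻¹)⁻¹ = g * (w * s * w⁻¹) * g⁻¹ := by group
    _ = _ := by rw [hw s hs]; group

theorem isReflected_conj_iff {S : Subgroup G} {g : G} :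
    IsReflected (conjSubgroup g S) ↔ IsReflected S := by
  refine ⟨fun h => ?_, fun h => h.conj g⟩
  have h1 := h.conj g⁻¹
  rwa [conjSubgroup_conjSubgroup, inv_mul_cancel, conjSubgroup_one] at h1

theorem isConjugateInto_conj_iff {S H : Subgroup G} {g : G} :
    IsConjugateInto (conjSubgroup g S) H ↔ IsConjugateInto S H := by
  constructor
  · rintro ⟨h, hh⟩
    exact ⟨h * g, by rwa [← conjSubgroup_conjSubgroup]⟩
  · rintro ⟨h, hh⟩
    exact ⟨h * g⁻¹, by rwa [conjSubgroup_conjSubgroup, inv_mul_cancel_right]⟩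

theorem IsCircle.exists_hom [TopologicalSpace G] {S : Subgroup G} (h : IsCircle S) :
    ∃ ρ : Circle →* G, Continuous ρ ∧ Function.Injective ρ ∧ ρ.range = S := by
  obtain ⟨φ⟩ := h
  refine ⟨S.subtype.comp φ.toMulEquiv.toMonoidHom, continuous_subtype_val.comp φ.continuous,
    Subtype.val_injective.comp φ.injective, ?_⟩
  rw [MonoidHom.range_comp, MonoidHom.range_eq_top.2 φ.surjective, ← MonoidHom.range_eq_map,
    Subgroup.range_subtype]

theorem isReflected_range_iff {K : Type*} [Group K] {ρ : K →* G} :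
    IsReflected ρ.range ↔ ∃ w : G, ∀ z, w * ρ z * w⁻¹ = (ρ z)⁻¹ := by
  rw [isReflected_iff]
  exact exists_congr fun w => ⟨fun h z => h _ ⟨z, rfl⟩, by rintro h _ ⟨z, rfl⟩; exact h z⟩

end Groups

/-! ### Complex linear matrices have nonnegative determinant -/

/-- The rotation of the plane by a right angle. -/
def quarterTurn : Matrix (Fin 2) (Fin 2) ℝ := !![0, -1; 1, 0]

/-- This is the real form of the complex matrix `X + iY`. Over `ℂ`, a shear by `i` makes it block
triangular with conjugate diagonal blocks, so its determinant is `|det (X + iY)|²`. -/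
theorem det_fromBlocks_nonneg {k : ℕ} (X Y : Matrix (Fin k) (Fin k) ℝ) :
    0 ≤ (Matrix.fromBlocks X (-Y) Y X).det := by
  let X' : Matrix (Fin k) (Fin k) ℂ := X.map Complex.ofRealHom
  let Y' : Matrix (Fin k) (Fin k) ℂ := Y.map Complex.ofRealHom
  have h1 : (((Matrix.fromBlocks X (-Y) Y X).det : ℝ) : ℂ) =
      (Matrix.fromBlocks X' (-Y') Y' X').det := by
    rw [← Complex.ofRealHom_eq_coe, RingHom.map_det]
    congr 1
    rw [RingHom.mapMatrix_apply, Matrix.fromBlocks_map]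
    congr 1
    ext i j
    simp [Y']
  have h2 : Matrix.fromBlocks 1 (Complex.I • (1 : Matrix (Fin k) (Fin k) ℂ)) 0 1 *
      Matrix.fromBlocks X' (-Y') Y' X' *
      Matrix.fromBlocks 1 (-(Complex.I • (1 : Matrix (Fin k) (Fin k) ℂ))) 0 1 =
      Matrix.fromBlocks (X' + Complex.I • Y') 0 Y' (X' - Complex.I • Y') := by
    simp only [Matrix.fromBlocks_multiply]
    congr 1
    · simp
    · simp [smul_smul]
      abel
    · simp
    · simp [sub_eq_neg_add]
  have h3 := congrArg Matrix.det h2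
  rw [Matrix.det_mul, Matrix.det_mul, Matrix.det_fromBlocks_zero₂₁, Matrix.det_fromBlocks_zero₂₁,
    Matrix.det_fromBlocks_zero₁₂] at h3
  simp only [Matrix.det_one, one_mul, mul_one] at h3
  have h4 : (X' - Complex.I • Y').det = (starRingEnd ℂ) (X' + Complex.I • Y').det := by
    rw [RingHom.map_det]
    congr 1
    ext i j
    simp [X', Y', sub_eq_add_neg]
  rw [h4, Complex.mul_conj] at h3
  rw [h3] at h1
  have h5 : (Matrix.fromBlocks X (-Y) Y X).det = Complex.normSq (X' + Complex.I • Y').det := by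
    exact_mod_cast h1
  rw [h5]
  exact Complex.normSq_nonneg _

/-- Commuting with the quarter turns is complex linearity; `f` lists the first coordinates of all
blocks before the second ones. -/
theorem det_nonneg_of_commute {k : ℕ} {M : Matrix (Fin 2 × Fin k) (Fin 2 × Fin k) ℝ}
    (h : M * Matrix.blockDiagonal (fun _ => quarterTurn) =
      Matrix.blockDiagonal (fun _ => quarterTurn) * M) : 0 ≤ M.det := by
  let f : Fin k ⊕ Fin k ≃ Fin 2 × Fin k :=
    ((finTwoEquiv.prodCongr (Equiv.refl _)).trans (Equiv.boolProdEquivSum _)).symm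
  have hl : ∀ i, f (.inl i) = (0, i) := fun i => rfl
  have hr : ∀ i, f (.inr i) = (1, i) := fun i => rfl
  have hent : ∀ (δ ε : Fin 2) (i j : Fin k), ∑ η, M (δ, i) (η, j) * quarterTurn η ε =
      ∑ η, quarterTurn δ η * M (η, i) (ε, j) := by
    intro δ ε i j
    have h1 := congrFun (congrFun h (δ, i)) (ε, j)
    simp only [Matrix.mul_apply, Fintype.sum_prod_type, Matrix.blockDiagonal_apply, mul_ite,
      ite_mul, mul_zero, zero_mul, Finset.sum_ite_eq, Finset.sum_ite_eq', Finset.mem_univ,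
      if_true] at h1
    exact h1
  rw [← Matrix.det_submatrix_equiv_self f M]
  convert det_fromBlocks_nonneg (Matrix.of fun i j => M (0, i) (0, j))
    (Matrix.of fun i j => M (1, i) (0, j)) using 2
  ext (i | i) (j | j)
  · simp [hl]
  · have h1 := hent 0 0 i j
    simp [quarterTurn, Fin.sum_univ_two] at h1
    simp [hl, hr, h1]
  · simp [hl, hr]
  · have h1 := hent 1 0 i j
    simp [quarterTurn, Fin.sum_univ_two] at h1
    simp [hr, h1]

/-! ### Reflected circles in the special orthogonal group -/

section Torus

variable {m k : ℕ} {e : Fin 2 × Fin k ≃ Fin m}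

/-- `sin a = 0` for a nonzero integer `a` would make `π` rational. Thus `Circle.exp 1` is one
generic point that works for all nonzero exponents at once. -/
theorem im_exp_one_zpow_ne_zero {a : ℤ} (ha : a ≠ 0) : ((Circle.exp 1 ^ a : Circle) : ℂ).im ≠ 0 := by
  rw [← Circle.exp_zsmul, Circle.coe_exp, Complex.exp_ofReal_mul_I_im]
  intro h
  obtain ⟨n, hn⟩ := Real.sin_eq_zero_iff.1 h
  have hn0 : n ≠ 0 := by
    rintro rfl
    simp at hn
    exact ha (by exact_mod_cast hn.symm)
  refine irrational_pi ⟨(a : ℚ) / n, ?_⟩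
  have hn' : (n : ℝ) ≠ 0 := by exact_mod_cast hn0
  have h2 : (n : ℝ) * Real.pi = a := by simpa using hn
  push_cast
  field_simp
  linarith

theorem rot_sub_rot_inv (z : Circle) : rot z - rot z⁻¹ = (2 * (z : ℂ).im) • quarterTurn := by
  ext i j
  fin_cases i <;> fin_cases j <;> simp [rot, quarterTurn] <;> ring

theorem rotMat_sub_rotMat_inv (a : Fin k → ℤ) (z : Circle) :
    (rotMat e a z - rotMat e a z⁻¹).submatrix e e =
      Matrix.blockDiagonal fun j => (2 * ((z ^ a j : Circle) : ℂ).im) • quarterTurn := by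
  have h : (fun j => (2 * ((z ^ a j : Circle) : ℂ).im) • quarterTurn) =
      (fun j => rot (z ^ a j)) - fun j => rot (z⁻¹ ^ a j) := by
    funext j
    rw [Pi.sub_apply, ← rot_sub_rot_inv, inv_zpow]
  rw [h, Matrix.blockDiagonal_sub]
  ext i j
  simp [rotMat]

theorem quarterTurn_mul_self : quarterTurn * quarterTurn = -1 := by
  ext i j
  fin_cases i <;> fin_cases j <;> simp [quarterTurn]

theorem flip_mul_quarterTurn : flip * quarterTurn = -(quarterTurn * flip) := by
  ext i j
  fin_cases i <;> fin_cases j <;> simp [quarterTurn, flip]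

/-- An orthogonal matrix inverting a block rotation with an odd number of blocks, all nontrivial,
does not have positive determinant. -/
theorem det_nonpos_of_anticommute (hk : Odd k) {W : Matrix (Fin 2 × Fin k) (Fin 2 × Fin k) ℝ}
    {r : Fin k → ℝ} (hr : ∀ j, r j ≠ 0)
    (hW : W * Matrix.blockDiagonal (fun j => r j • quarterTurn) =
      -(Matrix.blockDiagonal (fun j => r j • quarterTurn) * W)) : W.det ≤ 0 := by
  let A : Matrix (Fin 2 × Fin k) (Fin 2 × Fin k) ℝ :=
    Matrix.blockDiagonal fun j => r j • quarterTurn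
  let D : Matrix (Fin 2 × Fin k) (Fin 2 × Fin k) ℝ := Matrix.diagonal fun x => |r x.2|⁻¹
  let E : Matrix (Fin 2 × Fin k) (Fin 2 × Fin k) ℝ :=
    Matrix.blockDiagonal fun j => if r j < 0 then flip else 1
  let F : Matrix (Fin 2 × Fin k) (Fin 2 × Fin k) ℝ := Matrix.blockDiagonal fun _ => flip
  let J : Matrix (Fin 2 × Fin k) (Fin 2 × Fin k) ℝ := Matrix.blockDiagonal fun _ => quarterTurn
  have hWA : W * A = -(A * W) := hW
  have hAA : A * A = Matrix.diagonal fun x => -(r x.2 * r x.2) := by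
    simp only [A, ← Matrix.blockDiagonal_mul]
    ext ⟨δ, i⟩ ⟨ε, j⟩
    rw [Matrix.blockDiagonal_apply, Matrix.diagonal_apply]
    by_cases hij : i = j
    · subst hij
      by_cases hd : δ = ε
      · subst hd; simp [quarterTurn_mul_self]
      · simp [quarterTurn_mul_self, hd]
    · simp [hij]
  -- `W` commutes with `A² = -diag(r²)`, so its nonzero entries only join blocks with equal `|r|`;
  -- hence it commutes with `|r|⁻¹`.
  have hWD : W * D = D * W := by
    have h1 : W * (A * A) = (A * A) * W := by
      rw [← mul_assoc, hWA, neg_mul, mul_assoc, hWA, mul_neg, neg_neg, mul_assoc]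
    rw [hAA] at h1
    ext x y
    have h2 := congrFun (congrFun h1 x) y
    rw [Matrix.mul_diagonal, Matrix.diagonal_mul] at h2
    rw [Matrix.mul_diagonal, Matrix.diagonal_mul]
    by_cases h0 : W x y = 0
    · simp [h0]
    · have h3 : r y.2 * r y.2 = r x.2 * r x.2 := by
        apply mul_left_cancel₀ h0
        linarith
      rw [abs_eq_iff_mul_self_eq.2 h3, mul_comm]
  -- Dividing by `|r|` leaves a quarter turn up to sign in each block, and `E` flips exactly the
  -- negative ones.
  have hDAE : E * (D * A) * E = J := by
    have hD : D = Matrix.blockDiagonal fun j => |r j|⁻¹ • (1 : Matrix (Fin 2) (Fin 2) ℝ) := by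
      ext ⟨δ, i⟩ ⟨ε, j⟩
      simp only [D, Matrix.blockDiagonal_apply, Matrix.diagonal_apply, Prod.mk.injEq]
      by_cases hij : i = j <;> by_cases hd : δ = ε <;> simp [hij, hd]
    rw [hD]
    simp only [A, E, J, ← Matrix.blockDiagonal_mul]
    congr 1
    funext j
    rcases lt_or_gt_of_ne (hr j) with h | h
    · simp only [h, if_true, abs_of_neg h, smul_mul_assoc, mul_smul_comm, one_mul, smul_smul,
        flip_mul_quarterTurn, neg_mul, mul_assoc, flip_mul_flip, mul_one]
      rw [inv_neg, mul_neg, mul_inv_cancel₀ h.ne]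
      simp
    · simp only [not_lt.2 h.le, if_false, abs_of_pos h, smul_mul_assoc, mul_smul_comm, one_mul,
        smul_smul, mul_one, mul_inv_cancel₀ h.ne', one_smul]
  have hEE : E * E = 1 := by
    simp only [E, ← Matrix.blockDiagonal_mul]
    rw [← Matrix.blockDiagonal_one]
    congr 1
    funext j
    split_ifs <;> simp [flip_mul_flip]
  have hFJ : F * J = -(J * F) := by
    simp only [F, J, ← Matrix.blockDiagonal_mul]
    rw [← Matrix.blockDiagonal_neg]
    congr 1
    funext j
    exact flip_mul_quarterTurn
  have hWJ : (E * W * E) * J = -(J * (E * W * E)) := by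
    calc (E * W * E) * J = E * W * (E * E) * (D * A) * E := by rw [← hDAE]; simp only [mul_assoc]
      _ = E * (W * D) * A * E := by rw [hEE]; simp only [mul_assoc, one_mul]
      _ = E * D * (W * A) * E := by rw [hWD]; simp only [mul_assoc]
      _ = -(E * (D * A) * (E * E) * W * E) := by
        rw [hWA, hEE]; simp only [mul_assoc, mul_neg, neg_mul, one_mul]
      _ = _ := by rw [← hDAE]; simp only [mul_assoc]
  -- Both `E W E` and `F` anticommute with the complex structure `J`, so their product is complex
  -- linear. Since `k` is odd, `det F = (-1)^k = -1`, which turns nonnegativity into `det W ≤ 0`.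
  have hM : (E * W * E * F) * J = J * (E * W * E * F) := by
    rw [mul_assoc _ F J, hFJ, mul_neg, ← mul_assoc, hWJ, neg_mul, neg_neg, mul_assoc]
  have h1 := det_nonneg_of_commute hM
  have hE : E.det * E.det = 1 := by rw [← Matrix.det_mul, hEE, Matrix.det_one]
  have hF : F.det = -1 := by
    simp [F, Matrix.det_blockDiagonal, flip, Matrix.det_fin_two, hk.neg_one_pow]
  rw [Matrix.det_mul, Matrix.det_mul, Matrix.det_mul, hF] at h1
  have h2 : E.det * W.det * E.det * -1 = -W.det := by linear_combination (-W.det) * hE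
  linarith

/-- An element exchanging the rotation and its inverse anticommutes with their difference; with all
exponents nonzero this contradicts `det w = 1`. -/
theorem exists_eq_zero_of_reflector (hk : Odd k) {a : Fin k → ℤ} {w : SO m}
    (hw : ∀ z, (w : Matrix (Fin m) (Fin m) ℝ) * rotMat e a z = rotMat e a z⁻¹ * w) :
    ∃ j, a j = 0 := by
  by_contra! ha
  have h1 : (w : Matrix (Fin m) (Fin m) ℝ) *
      (rotMat e a (Circle.exp 1) - rotMat e a (Circle.exp 1)⁻¹) =
      -((rotMat e a (Circle.exp 1) - rotMat e a (Circle.exp 1)⁻¹) * w) := by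
    have h2 := hw (Circle.exp 1)⁻¹
    rw [inv_inv] at h2
    rw [mul_sub, hw, h2, sub_mul, neg_sub]
  have h2 := congrArg (fun M => M.submatrix e e) h1
  simp only [Matrix.submatrix_neg, Pi.neg_apply, ← Matrix.submatrix_mul_equiv _ _ _ e] at h2
  rw [rotMat_sub_rotMat_inv] at h2
  have h3 := det_nonpos_of_anticommute hk
    (fun j => mul_ne_zero two_ne_zero (im_exp_one_zpow_ne_zero (ha j))) h2
  rw [Matrix.det_submatrix_equiv_self, SO.det_eq_one] at h3
  norm_num at h3

/-- A fixed vector is killed by the difference of the rotation and its inverse, whose determinant is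
the product of the `(2 sin a_j)²` at the generic point. -/
theorem exists_eq_zero_of_fixed {a : Fin k → ℤ} {u : Fin m → ℝ} (hu : u ≠ 0)
    (h : ∀ z, rotMat e a z *ᵥ u = u) : ∃ j, a j = 0 := by
  by_contra! ha
  have h1 : (rotMat e a (Circle.exp 1) - rotMat e a (Circle.exp 1)⁻¹) *ᵥ u = 0 := by
    rw [Matrix.sub_mulVec, h, h, sub_self]
  have h2 : (rotMat e a (Circle.exp 1) - rotMat e a (Circle.exp 1)⁻¹).det ≠ 0 := by
    rw [← Matrix.det_submatrix_equiv_self e, rotMat_sub_rotMat_inv, Matrix.det_blockDiagonal]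
    refine Finset.prod_ne_zero_iff.2 fun j _ => ?_
    rw [Matrix.det_smul]
    exact mul_ne_zero (pow_ne_zero _ (mul_ne_zero two_ne_zero (im_exp_one_zpow_ne_zero (ha j))))
      (by simp [quarterTurn, Matrix.det_fin_two])
  exact hu (Matrix.eq_zero_of_mulVec_eq_zero h2 h1)

end Torus

/-! ### The block-diagonal subgroup and exponents -/

theorem blockMat_natAdd (k : ℕ) (A : Matrix (Fin k) (Fin k) ℝ) (r : Fin (k + 2)) (i : Fin 2) :
    blockMat k A r (Fin.natAdd k i) = (1 : Matrix (Fin (k + 2)) (Fin (k + 2)) ℝ) r (Fin.natAdd k i) := by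
  refine Fin.addCases (fun r => ?_) (fun r => ?_) r
  · have h : Fin.castAdd 2 r ≠ Fin.natAdd k i := fun h => by
      have := congrArg Fin.val h
      simp at this
      omega
    simp [blockMat, h]
  · simp [blockMat, Matrix.one_apply]

theorem blockMat_injective (k : ℕ) : Function.Injective (blockMat k) := by
  intro A B h
  have h1 := (Matrix.reindex finSumFinEquiv finSumFinEquiv).injective h
  exact (Matrix.fromBlocks_inj.1 h1).1

/-- Fixing the last two basis vectors suffices: by orthogonality the transpose fixes them too, so
the last two rows are also standard. -/
theorem mem_stdSO_iff {k : ℕ} {A : SO (k + 2)} :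
    A ∈ stdSO k ↔ ∀ r i, (A : Matrix (Fin (k + 2)) (Fin (k + 2)) ℝ) r (Fin.natAdd k i) =
      (1 : Matrix (Fin (k + 2)) (Fin (k + 2)) ℝ) r (Fin.natAdd k i) := by
  constructor
  · rintro ⟨B, rfl⟩ r i
    exact blockMat_natAdd k _ r i
  · intro h
    have hcol : ∀ i, (A : Matrix (Fin (k + 2)) (Fin (k + 2)) ℝ) *ᵥ Pi.single (Fin.natAdd k i) 1 =
        Pi.single (Fin.natAdd k i) 1 := by
      intro i
      ext r
      rw [Matrix.mulVec_single_one]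
      simp [h, Matrix.one_apply, Pi.single_apply]
    have hrow : ∀ r i, (A : Matrix (Fin (k + 2)) (Fin (k + 2)) ℝ) (Fin.natAdd k i) r =
        (1 : Matrix (Fin (k + 2)) (Fin (k + 2)) ℝ) (Fin.natAdd k i) r := by
      intro r i
      have h1 := congrArg (fun v => (A : Matrix (Fin (k + 2)) (Fin (k + 2)) ℝ)ᵀ *ᵥ v) (hcol i)
      simp only [Matrix.mulVec_mulVec, SO.transpose_mul_self, Matrix.one_mulVec] at h1
      have h2 := congrFun h1 r
      rw [Matrix.mulVec_single_one] at h2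
      simpa [Matrix.one_apply, Pi.single_apply, eq_comm] using h2.symm
    let B : Matrix (Fin k) (Fin k) ℝ :=
      Matrix.of fun i j => (A : Matrix (Fin (k + 2)) (Fin (k + 2)) ℝ) (Fin.castAdd 2 i) (Fin.castAdd 2 j)
    have hAB : blockMat k B = A := by
      have hne : ∀ (r : Fin k) (i : Fin 2), Fin.castAdd 2 r ≠ Fin.natAdd k i := fun r i h => by
        have := congrArg Fin.val h
        simp at this
        omega
      ext r s
      refine Fin.addCases (fun s => ?_) (fun s => ?_) s
      · refine Fin.addCases (fun r => ?_) (fun r => ?_) r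
        · simp [blockMat, B]
        · rw [hrow]
          simp [blockMat, (hne _ _).symm]
      · rw [h, blockMat_natAdd]
    have hBt : (blockMat k B)ᵀ = blockMat k Bᵀ := by
      simp [blockMat, Matrix.fromBlocks_transpose]
    have hB : B ∈ Matrix.specialOrthogonalGroup (Fin k) ℝ := by
      rw [Matrix.mem_specialOrthogonalGroup_iff, Matrix.mem_orthogonalGroup_iff]
      constructor
      · apply blockMat_injective
        change blockMat k (B * Bᵀ) = _
        rw [blockMat_mul, ← hBt, hAB, SO.mul_transpose_self, blockMat_one]
      · have h1 : (blockMat k B).det = B.det := by simp [blockMat]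
        rw [← h1, hAB, SO.det_eq_one]
    exact ⟨⟨B, hB⟩, Subtype.ext hAB⟩

theorem blockEquiv_last (n : ℕ) (i : Fin 2) :
    blockEquiv n (i, Fin.last (2 * n)) = Fin.natAdd (4 * n) i := by
  apply Fin.ext
  simp [blockEquiv]
  ring

theorem coe_torusHom (n : ℕ) (a : Fin (2 * n + 1) → ℤ) (z : Circle) :
    (torusHom n a z : Matrix (Fin (4 * n + 2)) (Fin (4 * n + 2)) ℝ) =
      rotMat (blockEquiv n) a z := rfl

theorem torusHom_mem_stdSO {n : ℕ} {a : Fin (2 * n + 1) → ℤ} (h : a (Fin.last (2 * n)) = 0)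
    (z : Circle) : torusHom n a z ∈ stdSO (4 * n) := by
  rw [mem_stdSO_iff]
  intro r i
  rw [coe_torusHom, ← blockEquiv_last]
  obtain ⟨⟨δ, j⟩, rfl⟩ := (blockEquiv n).surjective r
  by_cases hj : j = Fin.last (2 * n)
  · subst hj
    simp [rotMat, h, rot_one, Matrix.one_apply]
  · simp [rotMat, Matrix.blockDiagonal_apply, hj]

theorem isDiagonalizer_torusHom (n : ℕ) (a : Fin (2 * n + 1) → ℤ) :
    IsDiagonalizer (blockEquiv n) (torusHom n a) 1 a :=
  ⟨by simp, fun z => by rw [coe_torusHom]; simp⟩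

/-- A diagonalizer in the special orthogonal group conjugates onto the torus homomorphism. -/
theorem IsDiagonalizer.mul_mul_inv {n : ℕ} {ρ : Circle →* SO (4 * n + 2)} {g : SO (4 * n + 2)}
    {a : Fin (2 * n + 1) → ℤ} (h : IsDiagonalizer (blockEquiv n) ρ g a) (z : Circle) :
    g * ρ z * g⁻¹ = torusHom n a z :=
  Subtype.ext (h.conj z)

/-- Permuting the blocks of a torus homomorphism. -/
theorem isDiagonalizer_perm (n : ℕ) (a : Fin (2 * n + 1) → ℤ) (σ : Equiv.Perm (Fin (2 * n + 1))) :
    ∃ G, IsDiagonalizer (blockEquiv n) (torusHom n a) G (a ∘ σ) := by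
  let e := blockEquiv n
  let τ : Equiv.Perm (Fin (4 * n + 2)) := (e.symm.trans ((Equiv.refl _).prodCongr σ)).trans e
  have key : ∀ M : Matrix (Fin (4 * n + 2)) (Fin (4 * n + 2)) ℝ,
      (1 : Matrix (Fin (4 * n + 2)) (Fin (4 * n + 2)) ℝ).submatrix τ id * M *
        ((1 : Matrix (Fin (4 * n + 2)) (Fin (4 * n + 2)) ℝ).submatrix τ id)ᵀ = M.submatrix τ τ := by
    intro M
    ext i j
    simp [Matrix.mul_apply, Matrix.one_apply]
  refine ⟨(1 : Matrix (Fin (4 * n + 2)) (Fin (4 * n + 2)) ℝ).submatrix τ id, ?_, fun z => ?_⟩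
  · have h := key 1
    rwa [mul_one, Matrix.submatrix_one_equiv] at h
  · rw [key]
    ext i j
    obtain ⟨⟨δ, i⟩, rfl⟩ := (blockEquiv n).surjective i
    obtain ⟨⟨ε, j⟩, rfl⟩ := (blockEquiv n).surjective j
    simp [coe_torusHom, rotMat, τ, e, Matrix.blockDiagonal_apply]

theorem isReflected_torus_iff (n : ℕ) (a : Fin (2 * n + 1) → ℤ) :
    IsReflected (torusHom n a).range ↔ ∃ j, a j = 0 := by
  rw [isReflected_range_iff]
  constructor
  · rintro ⟨w, hw⟩
    refine exists_eq_zero_of_reflector (e := blockEquiv n) ⟨n, rfl⟩ (w := w) fun z => ?_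
    have h := hw z
    rw [← map_inv, mul_inv_eq_iff_eq_mul] at h
    exact congrArg Subtype.val h
  · rintro ⟨j, hj⟩
    -- All blocks but the trivial one are flipped, `2n` in number.
    refine (isDiagonalizer_torusHom n a).exists_reflector (s := Finset.univ.erase j) ?_ ?_
    · rw [Finset.card_erase_of_mem (Finset.mem_univ j), Finset.card_univ, Fintype.card_fin]
      exact ⟨n, by omega⟩
    · intro i hi
      have : i = j := by simpa using hi
      rw [this, hj]

/-- Pulling the last-but-one basis vector back by `g` gives a vector fixed by the torus circle.
Conversely a trivial block is swapped to the end, and correcting the determinant there keeps its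
exponent zero. -/
theorem isConjugateInto_torus_iff (n : ℕ) (a : Fin (2 * n + 1) → ℤ) :
    IsConjugateInto (torusHom n a).range (stdSO (4 * n)) ↔ ∃ j, a j = 0 := by
  constructor
  · rintro ⟨g, hg⟩
    let v : Fin (4 * n + 2) → ℝ := Pi.single (Fin.natAdd (4 * n) 0) 1
    have hv : v ≠ 0 := by simp [v]
    have hfix : ∀ A ∈ stdSO (4 * n), (A : Matrix (Fin (4 * n + 2)) (Fin (4 * n + 2)) ℝ) *ᵥ v = v := by
      intro A hA
      ext r
      rw [Matrix.mulVec_single_one]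
      simp [mem_stdSO_iff.1 hA, Matrix.one_apply, v, Pi.single_apply]
    refine exists_eq_zero_of_fixed (e := blockEquiv n)
      (u := (g : Matrix (Fin (4 * n + 2)) (Fin (4 * n + 2)) ℝ)ᵀ *ᵥ v) ?_ fun z => ?_
    · intro h0
      apply hv
      have h1 := congrArg
        (fun u => (g : Matrix (Fin (4 * n + 2)) (Fin (4 * n + 2)) ℝ) *ᵥ u) h0
      simpa [Matrix.mulVec_mulVec, SO.mul_transpose_self] using h1
    · have h1 := hfix _ (hg (mem_conjSubgroup.2 ⟨_, ⟨z, rfl⟩, rfl⟩))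
      have h2 := congrArg
        (fun u => (g : Matrix (Fin (4 * n + 2)) (Fin (4 * n + 2)) ℝ)ᵀ *ᵥ u) h1
      have h3 : ((g * torusHom n a z * g⁻¹ : SO (4 * n + 2)) :
          Matrix (Fin (4 * n + 2)) (Fin (4 * n + 2)) ℝ) =
          (g : Matrix (Fin (4 * n + 2)) (Fin (4 * n + 2)) ℝ) * rotMat (blockEquiv n) a z *
            (g : Matrix (Fin (4 * n + 2)) (Fin (4 * n + 2)) ℝ)ᵀ := rfl
      simp only [h3, Matrix.mulVec_mulVec, ← mul_assoc, SO.transpose_mul_self, one_mul] at h2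
      rw [Matrix.mulVec_mulVec, h2]
  · rintro ⟨j, hj⟩
    obtain ⟨G, hG⟩ := isDiagonalizer_perm n a (Equiv.swap j (Fin.last (2 * n)))
    obtain ⟨g, b, hb, hb0⟩ := hG.exists_specialOrthogonal (Fin.last (2 * n))
    refine ⟨g, fun x hx => ?_⟩
    obtain ⟨_, ⟨z, rfl⟩, rfl⟩ := mem_conjSubgroup.1 hx
    rw [hb.mul_mul_inv]
    exact torusHom_mem_stdSO (hb0 (by simpa using hj)) z

/-! ### Circles in the special orthogonal group -/

theorem IsCircle.exists_hasExponents {n : ℕ} {S : Subgroup (SO (4 * n + 2))} (hS : IsCircle S) :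
    ∃ a : Fin (2 * n + 1) → ℤ, HasExponents S a := by
  obtain ⟨ρ, hρ, hinj, rfl⟩ := hS.exists_hom
  obtain ⟨G, a, hG⟩ := exists_isDiagonalizer (blockEquiv n) hρ
  obtain ⟨g, b, hb, -⟩ := hG.exists_specialOrthogonal 0
  refine ⟨b, fun z w hzw => hinj ?_, g, ?_⟩
  · rw [← hb.mul_mul_inv, ← hb.mul_mul_inv] at hzw
    exact mul_left_cancel (mul_right_cancel hzw)
  · ext x
    simp [mem_conjSubgroup, hb.mul_mul_inv]

theorem HasExponents.isReflected_iff {n : ℕ} {S : Subgroup (SO (4 * n + 2))}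
    {a : Fin (2 * n + 1) → ℤ} (h : HasExponents S a) : IsReflected S ↔ ∃ j, a j = 0 := by
  obtain ⟨-, g, hg⟩ := h
  rw [← isReflected_torus_iff, ← hg, isReflected_conj_iff]

theorem HasExponents.isConjugateInto_iff {n : ℕ} {S : Subgroup (SO (4 * n + 2))}
    {a : Fin (2 * n + 1) → ℤ} (h : HasExponents S a) :
    IsConjugateInto S (stdSO (4 * n)) ↔ ∃ j, a j = 0 := by
  obtain ⟨-, g, hg⟩ := h
  rw [← isConjugateInto_torus_iff, ← hg, isConjugateInto_conj_iff]

theorem IsCircle.isReflected_iff_isConjugateInto_stdSO {n : ℕ} {S : Subgroup (SO (4 * n + 2))}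
    (hS : IsCircle S) : IsReflected S ↔ IsConjugateInto S (stdSO (4 * n)) := by
  obtain ⟨a, ha⟩ := hS.exists_hasExponents
  rw [ha.isReflected_iff, ha.isConjugateInto_iff]

section Spin

open CliffordAlgebra

/-! ### Images of circles -/

theorem Circle.eq_of_sq_eq_one {x y : Circle} (hx : x * x = 1) (hy : y * y = 1) (hx1 : x ≠ 1)
    (hy1 : y ≠ 1) : x = y := by
  have h : ∀ w : Circle, w * w = 1 → w ≠ 1 → (w : ℂ) = -1 := by
    intro w hw hw1
    have h1 : (w : ℂ) * w = 1 := by rw [← Circle.coe_mul, hw, Circle.coe_one]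
    rcases mul_self_eq_one_iff.1 h1 with h2 | h2
    · exact absurd (Circle.ext h2) hw1
    · exact h2
  exact Circle.ext ((h x hx hx1).trans (h y hy hy1).symm)

theorem exists_mul_self_eq (z : Circle) : ∃ w : Circle, w * w = z := by
  refine ⟨Circle.exp (Complex.arg z / 2), ?_⟩
  rw [← Circle.exp_add, add_halves, Circle.exp_arg]

section CircleImage

variable {H : Type*} [Group H] [TopologicalSpace H] [T2Space H]

theorem isCircle_range_of_injective {φ : Circle →* H} (hφ : Continuous φ)
    (hinj : Function.Injective φ) : IsCircle φ.range := by
  let ψ : Circle ≃* φ.range := MonoidHom.ofInjective hinj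
  have hψ : Continuous ψ := hφ.subtype_mk _
  exact ⟨{ ψ with
    continuous_toFun := hψ
    continuous_invFun := (hψ.homeoOfEquivCompactToT2 (f := ψ.toEquiv)).continuous_symm }⟩

/-- Either `φ` is injective or its kernel is `{1, -1}`; in the second case it factors through
squaring as an injective homomorphism with the same range. -/
theorem isCircle_range_of_ker {φ : Circle →* H} (hφ : Continuous φ)
    (hker : ∀ z, φ z = 1 → z * z = 1) : IsCircle φ.range := by
  by_cases hinj : Function.Injective φ
  · exact isCircle_range_of_injective hφ hinj
  obtain ⟨ε, hε, hε1⟩ : ∃ ε, φ ε = 1 ∧ ε ≠ 1 := by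
    by_contra! h
    exact hinj ((injective_iff_map_eq_one φ).2 h)
  have hker' : ∀ z, z * z = 1 → φ z = 1 := by
    intro z hz
    by_cases h1 : z = 1
    · rw [h1, map_one]
    · rw [Circle.eq_of_sq_eq_one hz (hker ε hε) h1 hε1, hε]
  -- The chosen square root need not be continuous. Its sign ambiguity lies in the kernel of `φ`,
  -- and continuity of `ψ` comes from squaring being a quotient map.
  choose r hr using exists_mul_self_eq
  have hφr : ∀ z, φ (r (z * z)) = φ z := by
    intro z
    rw [← mul_inv_eq_one, ← map_inv, ← map_mul]
    apply hker'
    rw [mul_mul_mul_comm, hr, ← mul_inv, mul_inv_cancel]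
  let ψ : Circle →* H := MonoidHom.mk' (fun z => φ (r z)) fun z w => by
    obtain ⟨x, rfl⟩ := exists_mul_self_eq z
    obtain ⟨y, rfl⟩ := exists_mul_self_eq w
    rw [mul_mul_mul_comm, hφr, hφr, hφr, map_mul]
  have hψ : ∀ z, ψ (z * z) = φ z := hφr
  have hq : Topology.IsQuotientMap fun z : Circle => z * z :=
    have hc : Continuous fun z : Circle => z * z := continuous_id.mul continuous_id
    hc.isClosedMap.isQuotientMap hc exists_mul_self_eq
  have hcont : Continuous ψ := by
    rw [hq.continuous_iff]
    exact hφ.congr fun z => (hψ z).symm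
  have hψinj : Function.Injective ψ := by
    refine (injective_iff_map_eq_one ψ).2 fun z hz => ?_
    obtain ⟨x, rfl⟩ := exists_mul_self_eq z
    exact hker x ((hψ x).symm.trans hz)
  have hrange : ψ.range = φ.range := by
    ext x
    constructor
    · rintro ⟨z, rfl⟩
      exact ⟨r z, rfl⟩
    · rintro ⟨z, rfl⟩
      exact ⟨z * z, hψ z⟩
  exact hrange ▸ isCircle_range_of_injective hcont hψinj

end CircleImage

theorem IsCircle.imageSO {m : ℕ} {S : Subgroup (Spin m)} (hS : IsCircle S) :
    IsCircle (imageSO S) := by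
  obtain ⟨ρ, hρ, hinj, rfl⟩ := hS.exists_hom
  rw [imageSO_eq_map, ← MonoidHom.range_comp]
  refine isCircle_range_of_ker ((continuous_spinToSO m).comp hρ) fun z hz => hinj ?_
  rw [map_mul, map_one]
  exact sq_eq_one_of_spinToSO_eq_one hz

/-! ### Lifting reflections and conjugations -/

/-- A reflection of the image of a circle in the special orthogonal group lifts to the spin group. -/
theorem exists_reflector_of_spinToSO {m : ℕ} {ρ : Circle →* Spin m} {w : SO m}
    (hw : ∀ z, w * spinToSO m (ρ z) * w⁻¹ = (spinToSO m (ρ z))⁻¹) :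
    ∃ x : Spin m, ∀ z, x * ρ z * x⁻¹ = (ρ z)⁻¹ := by
  obtain ⟨x, rfl⟩ := spinToSO_surjective m w
  refine ⟨x, fun z => ?_⟩
  -- Over the relation in `SO(m)` the lift inverts `ρ u` only up to sign; squaring removes the sign.
  obtain ⟨u, rfl⟩ := exists_mul_self_eq z
  have h1 : spinToSO m (x * ρ u * x⁻¹ ) = spinToSO m (ρ u)⁻¹ := by
    rw [map_mul, map_mul, map_inv, map_inv, hw]
  have h2 : (x * ρ u * x⁻¹) * (x * ρ u * x⁻¹) = (ρ u)⁻¹ * (ρ u)⁻¹ := by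
    apply Subtype.ext
    rw [Submonoid.coe_mul _ (x * ρ u * x⁻¹), Submonoid.coe_mul _ (ρ u)⁻¹]
    rcases spinToSO_eq_iff.1 h1 with h | h <;> rw [h]
    rw [neg_mul_neg]
  rw [map_mul, mul_inv_rev, ← h2]
  group

theorem isReflected_imageSO_iff {m : ℕ} {S : Subgroup (Spin m)} (hS : IsCircle S) :
    IsReflected S ↔ IsReflected (imageSO S) := by
  obtain ⟨ρ, -, -, rfl⟩ := hS.exists_hom
  rw [imageSO_eq_map, ← MonoidHom.range_comp, isReflected_range_iff, isReflected_range_iff]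
  constructor
  · rintro ⟨w, hw⟩
    refine ⟨spinToSO m w, fun z => ?_⟩
    rw [MonoidHom.comp_apply, ← map_inv, ← map_inv, ← map_mul, ← map_mul, hw]
  · rintro ⟨w, hw⟩
    exact exists_reflector_of_spinToSO hw

/-- In dimension `4n` all `2n` blocks can be flipped with determinant `1`, whatever the exponents.
-/
theorem exists_reflector_spin_four_mul {n : ℕ} {ρ : Circle →* Spin (4 * n)} (hρ : Continuous ρ) :
    ∃ x : Spin (4 * n), ∀ z, x * ρ z * x⁻¹ = (ρ z)⁻¹ := by
  let e : Fin 2 × Fin (2 * n) ≃ Fin (4 * n) := finProdFinEquiv.trans (finCongr (by ring))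
  obtain ⟨G, a, h⟩ := exists_isDiagonalizer (ρ := (spinToSO (4 * n)).comp ρ) e
    ((continuous_spinToSO _).comp hρ)
  obtain ⟨w, hw⟩ := h.exists_reflector (s := Finset.univ) (by simp) (by simp)
  exact exists_reflector_of_spinToSO hw

theorem continuous_conj_spin {m : ℕ} (g : Spin m) : Continuous fun x : Spin m => g * x * g⁻¹ := by
  have : ContinuousAdd (Cl m) := IsModuleTopology.toContinuousAdd ℝ (Cl m)
  refine continuous_induced_rng.2 ?_
  have h : Continuous ((LinearMap.mulRight ℝ ((g⁻¹ : Spin m) : Cl m)).comp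
      (LinearMap.mulLeft ℝ (g : Cl m))) := IsModuleTopology.continuous_of_linearMap _
  exact h.comp continuous_subtype_val

/-- The inverting element is found inside the abstract `Spin(4n)` and carried over by `φ`, so the
position of `H` in the ambient group is irrelevant. -/
theorem isReflected_of_isConjugateInto {n m : ℕ} {S H : Subgroup (Spin m)} (hS : IsCircle S)
    (φ : Spin (4 * n) ≃ₜ* H) (h : IsConjugateInto S H) : IsReflected S := by
  obtain ⟨g, hg⟩ := h
  obtain ⟨ρ, hρ, -, rfl⟩ := hS.exists_hom
  have hmem : ∀ z, g * ρ z * g⁻¹ ∈ H := fun z => hg (mem_conjSubgroup.2 ⟨_, ⟨z, rfl⟩, rfl⟩)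
  let ψ : Circle →* H :=
    ((MulAut.conj g).toMonoidHom.comp ρ).codRestrict H hmem
  have hψ : Continuous ψ := ((continuous_conj_spin g).comp hρ).subtype_mk _
  obtain ⟨x, hx⟩ := exists_reflector_spin_four_mul
    (ρ := φ.symm.toMulEquiv.toMonoidHom.comp ψ) (φ.symm.continuous.comp hψ)
  rw [← isReflected_conj_iff (g := g), isReflected_iff]
  refine ⟨φ x, fun s hs => ?_⟩
  obtain ⟨_, ⟨z, rfl⟩, rfl⟩ := mem_conjSubgroup.1 hs
  have h1 := congrArg φ (hx z)
  rw [map_mul, map_mul, map_inv, map_inv] at h1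
  have h2 : φ ((φ.symm.toMulEquiv.toMonoidHom.comp ψ) z) = ψ z := φ.apply_symm_apply _
  rw [h2] at h1
  exact congrArg Subtype.val h1

/-! ### The standard subgroup -/

/-- The Clifford algebra of an orthogonal sum is a graded tensor product, where this map is `x ↦ x ⊗
1`; as a linear map that is the usual inclusion over a field. -/
theorem map_inl_injective {M N : Type*} [AddCommGroup M] [Module ℝ M] [AddCommGroup N]
    [Module ℝ N] (Q : QuadraticForm ℝ M) (Q' : QuadraticForm ℝ N) :
    Function.Injective (CliffordAlgebra.map (QuadraticMap.Isometry.inl Q Q')) := by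
  have h : ∀ x, ofProd Q Q' (CliffordAlgebra.map (QuadraticMap.Isometry.inl Q Q') x) =
      GradedTensorProduct.includeLeft (evenOdd Q) (evenOdd Q') x := by
    intro x
    rw [← AlgHom.comp_apply]
    congr 1
    ext v
    simp
  have h2 : Function.Injective (GradedTensorProduct.includeLeft (evenOdd Q) (evenOdd Q')) := by
    have h3 : Function.Injective (Algebra.TensorProduct.includeLeft :
        CliffordAlgebra Q →ₐ[ℝ] TensorProduct ℝ (CliffordAlgebra Q) (CliffordAlgebra Q')) :=
      Algebra.TensorProduct.includeLeft_injective (algebraMap ℝ (CliffordAlgebra Q')).injective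
    exact (GradedTensorProduct.of ℝ (evenOdd Q) (evenOdd Q')).injective.comp h3
  intro x y hxy
  exact h2 (by rw [← h, ← h, hxy])

/-- The splitting of Euclidean space into the first coordinates and the last two. -/
def splitIsometry (k : ℕ) :
    euclideanForm (k + 2) →qᵢ (euclideanForm k).prod (euclideanForm 2) where
  toFun v := (fun i => v (Fin.castAdd 2 i), fun i => v (Fin.natAdd k i))
  map_add' _ _ := rfl
  map_smul' _ _ := rfl
  map_app' v := by
    simp [euclideanForm, QuadraticMap.weightedSumSquares_apply, Fin.sum_univ_add,
      -Fin.sum_univ_two]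

theorem map_stdIncl_injective (k : ℕ) : Function.Injective (CliffordAlgebra.map (stdIncl k)) := by
  have h : (CliffordAlgebra.map (splitIsometry k)).comp (CliffordAlgebra.map (stdIncl k)) =
      CliffordAlgebra.map (QuadraticMap.Isometry.inl (euclideanForm k) (euclideanForm 2)) := by
    rw [map_comp_map]
    congr 1
    ext v : 1
    refine Prod.ext ?_ ?_
    · ext i
      exact Fin.append_left v (0 : Fin 2 → ℝ) i
    · ext i
      exact Fin.append_right v (0 : Fin 2 → ℝ) i
  have h2 := map_inl_injective (euclideanForm k) (euclideanForm 2)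
  rw [← h] at h2
  exact Function.Injective.of_comp h2

theorem stdIncl_dotProduct {k : ℕ} (v : Fin k → ℝ) : stdIncl k v ⬝ᵥ stdIncl k v = v ⬝ᵥ v := by
  rw [← euclideanForm_apply, ← euclideanForm_apply, QuadraticMap.Isometry.map_app]

theorem stdIncl_ne_zero {k : ℕ} {v : Fin k → ℝ} (hv : v ≠ 0) : stdIncl k v ≠ 0 := by
  intro h
  have h1 := stdIncl_dotProduct v
  rw [h, zero_dotProduct] at h1
  exact hv (dotProduct_self_eq_zero.1 h1.symm)

theorem map_vecProd {k : ℕ} (l : List (Fin k → ℝ)) :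
    CliffordAlgebra.map (stdIncl k) (vecProd l) = vecProd (l.map (stdIncl k)) := by
  induction l with
  | nil => simp
  | cons v l ih => rw [vecProd_cons, map_mul, ih, map_apply_ι, List.map_cons, vecProd_cons]

theorem reflMat_stdIncl {k : ℕ} (v : Fin k → ℝ) :
    reflMat (stdIncl k v) = blockMat k (reflMat v) := by
  have hne : ∀ (r : Fin k) (i : Fin 2), Fin.castAdd 2 r ≠ Fin.natAdd k i := fun r i h => by
    have := congrArg Fin.val h
    simp at this
    omega
  have hl : ∀ i, stdIncl k v (Fin.castAdd 2 i) = v i := Fin.append_left v (0 : Fin 2 → ℝ)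
  have hr : ∀ i, stdIncl k v (Fin.natAdd k i) = 0 := Fin.append_right v (0 : Fin 2 → ℝ)
  ext r s
  rw [reflMat, stdIncl_dotProduct]
  refine Fin.addCases (fun s => ?_) (fun s => ?_) s <;>
    refine Fin.addCases (fun r => ?_) (fun r => ?_) r
  · simp [blockMat, reflMat, Matrix.vecMulVec_apply, Matrix.one_apply, hl]
  · simp [blockMat, Matrix.vecMulVec_apply, hr, (hne _ _).symm]
  · simp [blockMat, Matrix.vecMulVec_apply, hr, hne]
  · simp [blockMat, Matrix.vecMulVec_apply, Matrix.one_apply, hr]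

theorem reflProd_map_stdIncl {k : ℕ} (l : List (Fin k → ℝ)) :
    reflProd (l.map (stdIncl k)) = blockMat k (reflProd l) := by
  induction l with
  | nil => simp [blockMat_one]
  | cons v l ih => rw [List.map_cons, reflProd_cons, ih, reflProd_cons, blockMat_mul, reflMat_stdIncl]

theorem map_stdIncl_mem {k : ℕ} (y : Spin k) :
    CliffordAlgebra.map (stdIncl k) (y : Cl k) ∈ spinGroup (euclideanForm (k + 2)) := by
  obtain ⟨l, hl, he, h1, hy⟩ := exists_vecProd y
  rw [hy, map_vecProd]
  refine vecProd_mem_spinGroup ?_ (by simpa using he) ?_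
  · intro w hw
    obtain ⟨v, hv, rfl⟩ := List.mem_map.1 hw
    exact stdIncl_ne_zero (hl v hv)
  · rw [List.map_map, ← h1]
    congr 1
    exact List.map_congr_left fun v _ => stdIncl_dotProduct v

/-- The standard inclusion of spin groups. -/
def spinIncl (k : ℕ) : Spin k →* Spin (k + 2) where
  toFun y := ⟨CliffordAlgebra.map (stdIncl k) (y : Cl k), map_stdIncl_mem y⟩
  map_one' := Subtype.ext (by simp)
  map_mul' x y := Subtype.ext (by simp)

theorem range_spinIncl (k : ℕ) : (spinIncl k).range = stdSpin k := by
  ext x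
  exact ⟨fun ⟨y, hy⟩ => ⟨y, congrArg Subtype.val hy⟩, fun ⟨y, hy⟩ => ⟨y, Subtype.ext hy⟩⟩

/-- Write `y` as a product of vectors: the included vectors have as reflections the block extensions
of the original ones. -/
theorem spinToSO_spinIncl {k : ℕ} (y : Spin k) :
    spinToSO (k + 2) (spinIncl k y) = blockIncl k (spinToSO k y) := by
  obtain ⟨l, hl, he, -, hy⟩ := exists_vecProd y
  have h1 : spinToSO k y = ⟨reflProd l, reflProd_mem hl he⟩ :=
    (liesOver_of_vecProd hl he hy rfl).spinToSO_eq
  rw [h1]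
  refine (liesOver_of_vecProd (l := l.map (stdIncl k)) ?_ (by simpa using he) ?_ ?_).spinToSO_eq
  · intro w hw
    obtain ⟨v, hv, rfl⟩ := List.mem_map.1 hw
    exact stdIncl_ne_zero (hl v hv)
  · rw [← map_vecProd, ← hy]
    rfl
  · exact (reflProd_map_stdIncl l).symm

/-- The standard subgroup is isomorphic to the smaller spin group as a topological group. -/
theorem nonempty_spin_equiv_stdSpin (k : ℕ) : Nonempty (Spin k ≃ₜ* stdSpin k) := by
  have : ContinuousAdd (Cl k) := IsModuleTopology.toContinuousAdd ℝ (Cl k)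
  have : ContinuousAdd (Cl (k + 2)) := IsModuleTopology.toContinuousAdd ℝ (Cl (k + 2))
  have hinj : Function.Injective (spinIncl k) := fun x y h =>
    Subtype.ext (map_stdIncl_injective k (congrArg Subtype.val h))
  let f := (CliffordAlgebra.map (stdIncl k)).toLinearMap
  have hf : Continuous f := IsModuleTopology.continuous_of_linearMap f
  -- The inverse isomorphism is the restriction of a linear left inverse, hence continuous.
  obtain ⟨p, hp⟩ := f.exists_leftInverse_of_injective
    (LinearMap.ker_eq_bot.2 (map_stdIncl_injective k))
  have hpc : Continuous p := IsModuleTopology.continuous_of_linearMap p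
  rw [← range_spinIncl]
  let ψ : Spin k ≃* (spinIncl k).range := MonoidHom.ofInjective hinj
  have hψ : Continuous ψ := by
    refine continuous_induced_rng.2 (continuous_induced_rng.2 ?_)
    exact hf.comp continuous_subtype_val
  have hψ' : Continuous ψ.symm := by
    refine continuous_induced_rng.2 ?_
    refine (hpc.comp (continuous_subtype_val.comp continuous_subtype_val)).congr fun x => ?_
    obtain ⟨y, rfl⟩ := ψ.surjective x
    simp only [Function.comp_apply, MulEquiv.symm_apply_apply]
    exact LinearMap.congr_fun hp (y : Cl k)
  exact ⟨{ ψ with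
    continuous_toFun := hψ
    continuous_invFun := hψ' }⟩

/-- For `k > 0` the standard subgroup contains `-1`, so it is a full preimage. This fails for `k =
0`, where it is trivial while `-1 ∈ Spin(2)` lies over `1`. -/
theorem mem_stdSpin_iff {k : ℕ} (hk : 0 < k) {x : Spin (k + 2)} :
    x ∈ stdSpin k ↔ spinToSO (k + 2) x ∈ stdSO k := by
  constructor
  · rw [← range_spinIncl]
    rintro ⟨y, rfl⟩
    exact ⟨_, (spinToSO_spinIncl y).symm⟩
  · rintro ⟨A, hA⟩
    obtain ⟨y, rfl⟩ := spinToSO_surjective k A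
    rw [← spinToSO_spinIncl] at hA
    rcases spinToSO_eq_iff.1 hA.symm with h | h
    · exact ⟨y, h.symm⟩
    · refine ⟨⟨-1, neg_one_mem_spinGroup hk⟩ * y, ?_⟩
      rw [h, Submonoid.coe_mul, neg_one_mul, map_neg]
      rfl

theorem stdSO_zero : stdSO 0 = ⊥ := by
  rw [eq_bot_iff]
  rintro _ ⟨A, rfl⟩
  have hA : A = 1 := Subtype.ext (Subsingleton.elim _ _)
  rw [hA, map_one]
  exact one_mem _

theorem IsCircle.not_isConjugateInto_bot {G : Type*} [Group G] [TopologicalSpace G]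
    {S : Subgroup G} (hS : IsCircle S) : ¬ IsConjugateInto S ⊥ := by
  rintro ⟨g, hg⟩
  obtain ⟨φ⟩ := hS
  have h1 : ∀ s : S, s = 1 := fun s => by
    have h2 := hg (mem_conjSubgroup.2 ⟨s, s.2, rfl⟩)
    exact Subtype.ext (conj_eq_one_iff.1 (Subgroup.mem_bot.1 h2))
  have h2 : Circle.exp Real.pi = 1 := φ.injective ((h1 _).trans (h1 _).symm)
  have h3 := congrArg (fun z : Circle => (z : ℂ)) h2
  simp [Circle.coe_exp] at h3
  norm_num at h3

theorem isConjugateInto_stdSpin_iff {k : ℕ} {S : Subgroup (Spin (k + 2))} (hS : IsCircle S) :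
    IsConjugateInto S (stdSpin k) ↔ IsConjugateInto (imageSO S) (stdSO k) := by
  rw [imageSO_eq_map]
  constructor
  · rintro ⟨g, hg⟩
    refine ⟨spinToSO _ g, fun x hx => ?_⟩
    obtain ⟨_, ⟨s, hs, rfl⟩, rfl⟩ := mem_conjSubgroup.1 hx
    rw [← map_inv, ← map_mul, ← map_mul]
    have h1 := hg (mem_conjSubgroup.2 ⟨s, hs, rfl⟩)
    rw [← range_spinIncl] at h1
    obtain ⟨y, hy⟩ := h1
    exact ⟨_, by rw [← hy, spinToSO_spinIncl]⟩
  · intro h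
    -- For `k = 0` the target is trivial, and a circle is not conjugate into the trivial group.
    rcases Nat.eq_zero_or_pos k with rfl | hk
    · rw [stdSO_zero] at h
      exact absurd h (imageSO_eq_map S ▸ hS.imageSO).not_isConjugateInto_bot
    · obtain ⟨g, hg⟩ := h
      obtain ⟨x, rfl⟩ := spinToSO_surjective _ g
      refine ⟨x, fun y hy => ?_⟩
      obtain ⟨s, hs, rfl⟩ := mem_conjSubgroup.1 hy
      rw [mem_stdSpin_iff hk, map_mul, map_mul, map_inv]
      exact hg (mem_conjSubgroup.2 ⟨_, ⟨s, hs, rfl⟩, rfl⟩)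

theorem IsCircle.isReflected_iff_isConjugateInto_stdSpin {n : ℕ}
    {S : Subgroup (Spin (4 * n + 2))} (hS : IsCircle S) :
    IsReflected S ↔ IsConjugateInto S (stdSpin (4 * n)) := by
  rw [isReflected_imageSO_iff hS, isConjugateInto_stdSpin_iff hS,
    hS.imageSO.isReflected_iff_isConjugateInto_stdSO]

end Spin

end ReflectedCircles

end

/-! ### The proposition -/

theorem mainTheorem9 (n : ℕ) :
    (∀ S : Subgroup (ReflectedCircles.Spin (4 * n + 2)), ReflectedCircles.IsCircle S →
      (ReflectedCircles.IsReflected S ↔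
        ReflectedCircles.IsConjugateInto S (ReflectedCircles.stdSpin (4 * n))) ∧
      (ReflectedCircles.IsReflected S ↔
        ∃ H : Subgroup (ReflectedCircles.Spin (4 * n + 2)),
          Nonempty (ReflectedCircles.Spin (4 * n) ≃ₜ* H) ∧
            ReflectedCircles.IsConjugateInto S H) ∧
      ReflectedCircles.IsCircle (ReflectedCircles.imageSO S) ∧
      (ReflectedCircles.IsReflected S ↔
        ReflectedCircles.IsReflected (ReflectedCircles.imageSO S)) ∧
      (ReflectedCircles.IsConjugateInto S (ReflectedCircles.stdSpin (4 * n)) ↔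
        ReflectedCircles.IsConjugateInto (ReflectedCircles.imageSO S)
          (ReflectedCircles.stdSO (4 * n)))) ∧
    (∀ S : Subgroup (ReflectedCircles.SO (4 * n + 2)), ReflectedCircles.IsCircle S →
      (ReflectedCircles.IsReflected S ↔
        ReflectedCircles.IsConjugateInto S (ReflectedCircles.stdSO (4 * n))) ∧
      (∃ a : Fin (2 * n + 1) → ℤ, ReflectedCircles.HasExponents S a) ∧
      (∀ a : Fin (2 * n + 1) → ℤ, ReflectedCircles.HasExponents S a →
        (ReflectedCircles.IsReflected S ↔ ∃ j, a j = 0))) := by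
  refine ⟨fun S hS => ⟨hS.isReflected_iff_isConjugateInto_stdSpin, ⟨fun h => ?_, ?_⟩, hS.imageSO,
    ReflectedCircles.isReflected_imageSO_iff hS,
    ReflectedCircles.isConjugateInto_stdSpin_iff hS⟩, fun S hS =>
    ⟨hS.isReflected_iff_isConjugateInto_stdSO, hS.exists_hasExponents,
      fun a ha => ha.isReflected_iff⟩⟩
  · exact ⟨_, ReflectedCircles.nonempty_spin_equiv_stdSpin _,
      hS.isReflected_iff_isConjugateInto_stdSpin.1 h⟩
  · rintro ⟨H, ⟨φ⟩, h⟩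
    exact ReflectedCircles.isReflected_of_isConjugateInto hS φ h
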